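/- Let $(X,d)$ be a metric space whose topology is Polish (that is, separable and completely metrizable; $d$ itself need not be complete), and let $(\varphi_t)_{t\in\mathbb R}$ be a continuous flow on $X$. For $x\in X$ and $\varepsilon>0$ let $W^{ss}(x)$ be the set of $y\in X$ with $d(\varphi_t x,\varphi_t y)\to 0$ as $t\to+\infty$, let $W^{ss}_\varepsilon(x)$ be the set of $y\in W^{ss}(x)$ with $d(\varphi_t x,\varphi_t y)\le\varepsilon$ for all $t\ge 0$, and let $W^{su}_\varepsilon(x)$ be the corresponding set for the reversed flow $(\varphi_{-t})_{t\in\mathbb R}$. Assume: (1) (transitivity) for all nonempty open sets $U,V\subseteq X$ there is $t\ge 0$ with $\varphi_t(U)\cap V\neq\emptyset$; (2) (local product structure) every $v\in X$ has a neighborhood $V$ such that for all $\varepsilon>0$ there is $\delta>0$ such that for all $x,y\in V$ with $d(x,y)\le\delta$ there are a point $z\in X$ and a real number $t$ with $|t|\le\varepsilon$ and $z\in W^{su}_\varepsilon(\varphi_t x)\cap W^{ss}_\varepsilon(y)$; (3) (closing lemma) every $v\in X$ has a neighborhood $V$ such that for all $\varepsilon>0$ there are $\delta>0$ and $t_0>0$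 such that for all $x\in V$ and all $t>t_0$ with $d(x,\varphi_t x)<\delta$ and $\varphi_t x\in V$ there are $x_0\in X$ and $l>0$ with $|l-t|<\varepsilon$, $\varphi_l x_0=x_0$, and $d(\varphi_s x_0,\varphi_s x)<\varepsilon$ for all $0<s<\min(t,l)$. Let $\mathcal M^1(X)$ be the space of all Borel probability measures on $X$ that are invariant under every $\varphi_t$, with the weak topology (convergence of integrals of bounded continuous functions). Then the set of those $\mu\in\mathcal M^1(X)$ that are ergodic for the flow and have full support (every nonempty open set has positive $\mu$-measure) is a dense $G_\delta$ subset of $\mathcal M^1(X)$. -/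

import Mathlib

open MeasureTheory Filter Topology Set

namespace HyperbolicFlow

section Metric

/-- The strong stable set `W^{ss}(x)`: the points whose forward orbit is asymptotic to that
of `x`. -/
def strongStable {X : Type*} [MetricSpace X] (φ : Flow ℝ X) (x : X) : Set X :=
  {y | Tendsto (fun t : ℝ => dist (φ t x) (φ t y)) atTop (𝓝 0)}

/-- The local strong stable set `W^{ss}_ε(x)`. -/
def localStrongStable {X : Type*} [MetricSpace X] (φ : Flow ℝ X) (ε : ℝ) (x : X) : Set X :=
  {y | y ∈ strongStable φ x ∧ ∀ t : ℝ, 0 ≤ t → dist (φ t x) (φ t y) ≤ ε}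

/-- The local strong unstable set `W^{su}_ε(x)`: the local strong stable set of the
time-reversed flow `φ_{-t}`. -/
def localStrongUnstable {X : Type*} [MetricSpace X] (φ : Flow ℝ X) (ε : ℝ) (x : X) : Set X :=
  localStrongStable φ.reverse ε x

/-- The flow admits a local product structure. -/
def HasLocalProductStructure {X : Type*} [MetricSpace X] (φ : Flow ℝ X) : Prop :=
  ∀ v : X, ∃ V ∈ 𝓝 v, ∀ ε : ℝ, 0 < ε → ∃ δ : ℝ, 0 < δ ∧
    ∀ x ∈ V, ∀ y ∈ V, dist x y ≤ δ →
      ∃ (z : X) (t : ℝ), |t| ≤ ε ∧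
        z ∈ localStrongUnstable φ ε (φ t x) ∩ localStrongStable φ ε y

/-- The flow satisfies the closing lemma. -/
def SatisfiesClosingLemma {X : Type*} [MetricSpace X] (φ : Flow ℝ X) : Prop :=
  ∀ v : X, ∃ V ∈ 𝓝 v, ∀ ε : ℝ, 0 < ε → ∃ δ : ℝ, 0 < δ ∧ ∃ t₀ : ℝ, 0 < t₀ ∧
    ∀ x ∈ V, ∀ t : ℝ, t₀ < t → dist x (φ t x) < δ → φ t x ∈ V →
      ∃ (x₀ : X) (l : ℝ), 0 < l ∧ |l - t| < ε ∧ φ l x₀ = x₀ ∧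
        ∀ s : ℝ, 0 < s → s < min t l → dist (φ s x₀) (φ s x) < ε

end Metric

/-- The flow is (topologically) transitive: between any two nonempty open sets there is a
forward trajectory from the first to the second. -/
def IsTransitive {X : Type*} [TopologicalSpace X] (φ : Flow ℝ X) : Prop :=
  ∀ U V : Set X, IsOpen U → U.Nonempty → IsOpen V → V.Nonempty →
    ∃ t : ℝ, 0 ≤ t ∧ (φ t '' U ∩ V).Nonempty

section Measures

/-- The set `M¹(X)` of Borel probability measures invariant under the flow. As a subset of
`ProbabilityMeasure X` it carries the weak topology (convergence against bounded continuous
functions). -/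
def invariantMeasures {X : Type*} [TopologicalSpace X] [MeasurableSpace X] (φ : Flow ℝ X) :
    Set (ProbabilityMeasure X) :=
  {μ | ∀ t : ℝ, MeasurePreserving (φ t) (μ : Measure X) (μ : Measure X)}

/-- Ergodicity of a measure with respect to the flow, that is, with respect to the action of
the additive group `ℝ` that the flow defines. -/
def IsErgodic {X : Type*} [TopologicalSpace X] [MeasurableSpace X] (φ : Flow ℝ X)
    (μ : ProbabilityMeasure X) : Prop :=
  @ErgodicVAdd ℝ X φ.toAddAction.toVAdd _ (μ : Measure X)

/-- The measure has full support: every nonempty open set has positive measure. -/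
def HasFullSupport {X : Type*} [TopologicalSpace X] [MeasurableSpace X]
    (μ : ProbabilityMeasure X) : Prop :=
  (μ : Measure X).IsOpenPosMeasure

end Measures

end HyperbolicFlow

/-! The argument is a Baire category argument in the space `M` of invariant probability measures.
Probability measures on a Polish space form a Gδ in the compact space of probability measures on the
Hilbert cube, and `M` is closed among them, so `M` is a Baire space. It remains to see that
ergodicity and full support each define a dense Gδ.

Ergodicity is Gδ by the mean ergodic theorem: `μ` is ergodic iff, for each `f` in a countable family
whose integrals determine measures, some convex combination of translates of `f` has arbitrarily
small variance. For a fixed combination this is an open condition on `μ`. Full support means `μ U >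
0` for every `U` in a countable basis; each condition is open, and dense because periodic points are
dense: a small multiple of a periodic orbit measure charging `U` can be mixed into any `μ`.

Density of the ergodic measures is the dynamical core. Periodic orbit measures are ergodic, so it
suffices that they are dense (`invariantMeasures_subset_closure_periodicMeasures`). Weak
approximation only involves finitely many bounded Lipschitz functions, hence vectors of averages in
a finite-dimensional space. The closure of the vectors coming from periodic orbits is convex:
transitivity and the product structure give an orbit following one periodic orbit for a long time,
then another, then returning, with transition times independent of these lengths, and the closing
lemma makes it periodic (`exists_periodic_gluing`). If the vector of `μ` were outside this closed
convex set, Hahn–Banach would give a bounded Lipschitz function with nonnegative integral along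
every periodic orbit but negative `μ`-integral. Poincaré recurrence, the closing lemma and a maximal
ergodic inequality exclude this (`integral_nonneg_of_periodic`). -/

namespace HyperbolicFlow

/-! ### The weak topology tested on bounded Lipschitz functions -/

section WeakTopology

variable {X : Type*} [MetricSpace X]

/-- Bounded Lipschitz real functions. -/
def BoundedLipschitz (f : X → ℝ) : Prop :=
  ∃ B L : ℝ, 0 ≤ B ∧ 0 ≤ L ∧ (∀ x, |f x| ≤ B) ∧ ∀ x y, |f x - f y| ≤ L * dist x y

theorem BoundedLipschitz.continuous {f : X → ℝ} (hf : BoundedLipschitz f) : Continuous f := by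
  obtain ⟨B, L, -, hL, -, h⟩ := hf
  exact (LipschitzWith.of_dist_le_mul (K := ⟨L, hL⟩) h).continuous

/-- A bounded Lipschitz function as a bounded continuous function. -/
noncomputable def BoundedLipschitz.toBCF {f : X → ℝ} (hf : BoundedLipschitz f) :
    BoundedContinuousFunction X ℝ :=
  BoundedContinuousFunction.ofNormedAddCommGroup f hf.continuous hf.choose
    hf.choose_spec.choose_spec.2.2.1

theorem BoundedLipschitz.integrable [MeasurableSpace X] [BorelSpace X] {f : X → ℝ}
    (hf : BoundedLipschitz f) (μ : Measure X) [IsFiniteMeasure μ] : Integrable f μ :=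
  BoundedContinuousFunction.integrable μ hf.toBCF

theorem BoundedLipschitz.const (c : ℝ) : BoundedLipschitz fun _ : X => c :=
  ⟨|c|, 0, abs_nonneg c, le_rfl, fun _ => le_rfl, by simp⟩

theorem BoundedLipschitz.add {f g : X → ℝ} (hf : BoundedLipschitz f) (hg : BoundedLipschitz g) :
    BoundedLipschitz fun x => f x + g x := by
  obtain ⟨B, L, hB, hL, hb, hl⟩ := hf
  obtain ⟨B', L', hB', hL', hb', hl'⟩ := hg
  refine ⟨B + B', L + L', by positivity, by positivity, fun x => ?_, fun x y => ?_⟩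
  · exact (abs_add_le _ _).trans (add_le_add (hb x) (hb' x))
  · rw [add_mul, show f x + g x - (f y + g y) = (f x - f y) + (g x - g y) by ring]
    exact (abs_add_le _ _).trans (add_le_add (hl x y) (hl' x y))

theorem BoundedLipschitz.const_mul {f : X → ℝ} (c : ℝ) (hf : BoundedLipschitz f) :
    BoundedLipschitz fun x => c * f x := by
  obtain ⟨B, L, hB, hL, hb, hl⟩ := hf
  refine ⟨|c| * B, |c| * L, by positivity, by positivity, fun x => ?_, fun x y => ?_⟩
  · rw [abs_mul]; exact mul_le_mul_of_nonneg_left (hb x) (abs_nonneg c)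
  · rw [← mul_sub, abs_mul, mul_assoc]; exact mul_le_mul_of_nonneg_left (hl x y) (abs_nonneg c)

theorem BoundedLipschitz.sum {ι : Type*} (s : Finset ι) {f : ι → X → ℝ}
    (hf : ∀ i, BoundedLipschitz (f i)) : BoundedLipschitz fun x => ∑ i ∈ s, f i x := by
  classical
  induction s using Finset.induction_on with
  | empty => simpa using BoundedLipschitz.const (X := X) 0
  | insert a s ha ih => simpa [Finset.sum_insert ha] using (hf a).add ih

/-- A bounded continuous function is the pointwise limit of Lipschitz functions below it, with the
same bound. -/
theorem exists_lipschitz_approx_below {f : X → ℝ} (hf : Continuous f) {B : ℝ}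
    (hB : ∀ x, |f x| ≤ B) :
    ∃ g : ℕ → X → ℝ, (∀ n, BoundedLipschitz (g n)) ∧ (∀ n x, |g n x| ≤ B) ∧
      (∀ n x, g n x ≤ f x) ∧ ∀ x, Tendsto (fun n => g n x) atTop (𝓝 (f x)) := by
  rcases isEmpty_or_nonempty X with hX | hX
  · exact ⟨fun _ => f, fun _ => ⟨0, 0, le_rfl, le_rfl, fun x => hX.elim x, fun x => hX.elim x⟩,
      fun _ x => hX.elim x, fun _ x => hX.elim x, fun x => hX.elim x⟩
  have hB0 : 0 ≤ B := (abs_nonneg _).trans (hB hX.some)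
  -- The approximants are the inf-convolutions `⨅ y, f y + n * dist x y`, which are `n`-Lipschitz.
  have hlow : ∀ (n : ℕ) (x y : X), -B ≤ f y + n * dist x y := fun n x y => by
    have := (abs_le.1 (hB y)).1
    have : 0 ≤ (n : ℝ) * dist x y := by positivity
    linarith
  have hbdd : ∀ (n : ℕ) (x : X), BddBelow (range fun y => f y + n * dist x y) :=
    fun n x => ⟨-B, by rintro _ ⟨y, rfl⟩; exact hlow n x y⟩
  have hle : ∀ (n : ℕ) (x : X), (⨅ y, (f y + n * dist x y)) ≤ f x := fun n x =>
    (ciInf_le (hbdd n x) x).trans (by simp)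
  have hge : ∀ (n : ℕ) (x : X), -B ≤ ⨅ y, (f y + n * dist x y) := fun n x => le_ciInf (hlow n x)
  have habs : ∀ (n : ℕ) (x : X), |⨅ y, (f y + n * dist x y)| ≤ B := fun n x =>
    abs_le.2 ⟨hge n x, (hle n x).trans (abs_le.1 (hB x)).2⟩
  have hlip : ∀ (n : ℕ) (x z : X),
      (⨅ y, (f y + n * dist x y)) - (⨅ y, (f y + n * dist z y)) ≤ n * dist x z := by
    intro n x z
    rw [sub_le_iff_le_add, ← sub_le_iff_le_add']
    refine le_ciInf fun y => ?_
    rw [sub_le_iff_le_add]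
    refine (ciInf_le (hbdd n x) y).trans ?_
    have : (n : ℝ) * dist x y ≤ n * (dist x z + dist z y) :=
      mul_le_mul_of_nonneg_left (dist_triangle x z y) n.cast_nonneg
    linarith
  refine ⟨fun n x => ⨅ y, (f y + n * dist x y), fun n => ⟨B, n, hB0, n.cast_nonneg, habs n,
    fun x y => ?_⟩, habs, hle, fun x => ?_⟩
  · refine abs_le.2 ⟨?_, hlip n x y⟩
    have := hlip n y x
    rw [dist_comm] at this
    linarith
  · refine Metric.tendsto_atTop.2 fun ε hε => ?_
    obtain ⟨δ, hδ, hδf⟩ := Metric.continuous_iff.1 hf x (ε / 2) (half_pos hε)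
    -- Once `n * δ > 2 * B`, the penalty at distance at least `δ` exceeds the oscillation of `f`, so
    -- only points near `x` matter.
    obtain ⟨N, hN⟩ := exists_nat_gt (2 * B / δ)
    refine ⟨N, fun n hn => ?_⟩
    have h1 : f x - ε / 2 ≤ ⨅ y, (f y + n * dist x y) := by
      refine le_ciInf fun y => ?_
      rcases lt_or_ge (dist y x) δ with h | h
      · have h2 := hδf y h
        rw [Real.dist_eq, abs_lt] at h2
        have : 0 ≤ (n : ℝ) * dist x y := by positivity
        linarith
      · have h3 : 2 * B < n * δ := by
          have : (N : ℝ) ≤ n := by exact_mod_cast hn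
          exact (div_lt_iff₀ hδ).1 (hN.trans_le this)
        have h4 : (n : ℝ) * δ ≤ n * dist x y := by
          rw [dist_comm]; exact mul_le_mul_of_nonneg_left h n.cast_nonneg
        have h5 := (abs_le.1 (hB y)).1
        have h6 := (abs_le.1 (hB x)).2
        linarith
    rw [Real.dist_eq, abs_lt]
    constructor <;> linarith [hle n x]

variable [MeasurableSpace X] [BorelSpace X]

/-- Integrals of a bounded continuous function are approximated from below by integrals of
bounded Lipschitz functions. -/
theorem exists_lipschitz_integral_approx_below {f : X → ℝ} (hf : Continuous f) {B : ℝ}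
    (hB : ∀ x, |f x| ≤ B) (μ : Measure X) [IsFiniteMeasure μ] {ε : ℝ} (hε : 0 < ε) :
    ∃ g : X → ℝ, BoundedLipschitz g ∧ (∀ x, g x ≤ f x) ∧ ∫ x, f x ∂μ - ε < ∫ x, g x ∂μ := by
  obtain ⟨g, hg, hgB, hgf, hlim⟩ := exists_lipschitz_approx_below hf hB
  have : Tendsto (fun n => ∫ x, g n x ∂μ) atTop (𝓝 (∫ x, f x ∂μ)) :=
    tendsto_integral_of_dominated_convergence (fun _ => B)
      (fun n => (hg n).continuous.aestronglyMeasurable) (integrable_const B)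
      (fun n => Eventually.of_forall fun x => hgB n x) (Eventually.of_forall hlim)
  obtain ⟨n, hn⟩ := (this.eventually_const_lt (sub_lt_self _ hε)).exists
  exact ⟨g n, hg n, hgf n, hn⟩

/-- Weak convergence along an arbitrary filter can be tested on bounded Lipschitz functions. -/
theorem tendsto_of_forall_boundedLipschitz {ι : Type*} {F : Filter ι} {μs : ι → ProbabilityMeasure X}
    {μ : ProbabilityMeasure X}
    (h : ∀ f : X → ℝ, BoundedLipschitz f →
      Tendsto (fun i => ∫ x, f x ∂(μs i : Measure X)) F (𝓝 (∫ x, f x ∂(μ : Measure X)))) :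
    Tendsto μs F (𝓝 μ) := by
  have key : ∀ f : BoundedContinuousFunction X ℝ, ∀ ε : ℝ, 0 < ε →
      ∀ᶠ i in F, ∫ x, f x ∂(μ : Measure X) - ε < ∫ x, f x ∂(μs i : Measure X) := by
    intro f ε hε
    obtain ⟨g, hg, hgf, hlt⟩ := exists_lipschitz_integral_approx_below f.continuous
      f.norm_coe_le_norm (μ : Measure X) hε
    filter_upwards [(h g hg).eventually_const_lt hlt] with i hi
    exact hi.trans_le (integral_mono (hg.integrable _) (f.integrable _) hgf)
  refine ProbabilityMeasure.tendsto_iff_forall_integral_tendsto.2 fun f => ?_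
  rw [Metric.tendsto_nhds]
  intro ε hε
  filter_upwards [key f ε hε, key (-f) ε hε] with i h1 h2
  simp only [BoundedContinuousFunction.coe_neg, Pi.neg_apply, integral_neg] at h2
  rw [Real.dist_eq, abs_lt]
  constructor <;> linarith

/-- A probability measure is in the closure of a set as soon as it is approximated by elements of
the set on finitely many bounded Lipschitz functions. -/
theorem mem_closure_of_forall_boundedLipschitz {D : Set (ProbabilityMeasure X)}
    {μ : ProbabilityMeasure X}
    (h : ∀ (I : Finset {f : X → ℝ // BoundedLipschitz f}) (ε : ℝ), 0 < ε → ∃ ν ∈ D, ∀ f ∈ I,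
      |∫ x, f.1 x ∂(ν : Measure X) - ∫ x, f.1 x ∂(μ : Measure X)| < ε) :
    μ ∈ closure D := by
  let e : ProbabilityMeasure X → {f : X → ℝ // BoundedLipschitz f} → ℝ :=
    fun ν f => ∫ x, f.1 x ∂(ν : Measure X)
  have hcont : Continuous e := continuous_pi fun f =>
    ProbabilityMeasure.continuous_integral_boundedContinuousFunction f.2.toBCF
  -- The weak topology is induced by the integrals of bounded Lipschitz functions, so product
  -- neighborhoods, which constrain finitely many coordinates, suffice.
  have he : IsInducing e := by
    refine isInducing_iff_nhds.2 fun ν => le_antisymm hcont.continuousAt.le_comap ?_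
    refine tendsto_id'.1 <| tendsto_of_forall_boundedLipschitz (X := X) (μs := id) (μ := ν) fun f hf => ?_
    exact ((continuous_apply (⟨f, hf⟩ : {f : X → ℝ // BoundedLipschitz f})).tendsto (e ν)).comp
      tendsto_comap
  rw [he.closure_eq_preimage_closure_image, mem_preimage, mem_closure_iff_nhds]
  intro t ht
  rw [nhds_pi, Filter.mem_pi'] at ht
  obtain ⟨I, u, hu, hut⟩ := ht
  choose! r hr hru using fun f => Metric.mem_nhds_iff.1 (hu f)
  obtain ⟨ε, hε, hεr⟩ : ∃ ε > 0, ∀ f ∈ I, ε ≤ r f := by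
    rcases I.eq_empty_or_nonempty with rfl | hI
    · exact ⟨1, one_pos, by simp⟩
    · exact ⟨I.inf' hI r, (Finset.lt_inf'_iff hI).2 fun f _ => hr f, fun f hf =>
        Finset.inf'_le r hf⟩
  obtain ⟨ν, hν, hνI⟩ := h I ε hε
  refine ⟨e ν, hut fun f hf => hru f ?_, mem_image_of_mem e hν⟩
  exact (hνI f hf).trans_le (hεr f hf)

end WeakTopology


/-! ### Closed sets of probability measures on a Polish space are Baire -/

section BaireMeasures

open TopologicalSpace

/-- The range of an embedding of a completely metrizable space in a metrizable space is `Gδ`. -/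
theorem isGδ_range_of_isEmbedding {X Y : Type*} [TopologicalSpace X] [IsCompletelyMetrizableSpace X]
    [TopologicalSpace Y] [MetrizableSpace Y] {f : X → Y} (hf : IsEmbedding f) :
    IsGδ (range f) := by
  let := upgradeIsCompletelyMetrizable X
  let := metrizableSpaceMetric Y
  let O : ℕ → Set Y := fun n =>
    ⋃₀ {U | IsOpen U ∧ ∀ x y, f x ∈ U → f y ∈ U → dist x y < 1 / ((n : ℝ) + 1)}
  have hO : ∀ n, IsOpen (O n) := fun n => isOpen_sUnion fun U hU => hU.1
  -- `O n` is the union of the open sets whose preimage has small diameter. At a closure point lying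
  -- in all `O n`, the pulled-back neighborhood filter is Cauchy, and its limit is a preimage.
  have key : range f = closure (range f) ∩ ⋂ n, O n := by
    refine Subset.antisymm (subset_inter subset_closure ?_) ?_
    · rintro _ ⟨x, rfl⟩
      refine mem_iInter.2 fun n => ?_
      have hpos : 0 < 1 / ((n : ℝ) + 1) / 2 := by positivity
      obtain ⟨U, hU, hUx⟩ := hf.isInducing.isOpen_iff.1
        (Metric.isOpen_ball (x := x) (ε := 1 / ((n : ℝ) + 1) / 2))
      have hmem : ∀ z, f z ∈ U → dist z x < 1 / ((n : ℝ) + 1) / 2 := fun z hz => by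
        have : z ∈ f ⁻¹' U := hz
        rwa [hUx] at this
      refine mem_sUnion.2 ⟨U, ⟨hU, fun a b ha hb => ?_⟩, ?_⟩
      · linarith [dist_triangle_right a b x, hmem a ha, hmem b hb]
      · have : x ∈ f ⁻¹' U := by rw [hUx]; exact Metric.mem_ball_self hpos
        exact this
    · rintro y ⟨hy, hyO⟩
      have hne : (comap f (𝓝 y)).NeBot := by
        refine comap_neBot_iff.2 fun t ht => ?_
        obtain ⟨_, hzt, x, rfl⟩ := mem_closure_iff_nhds.1 hy t ht
        exact ⟨x, hzt⟩
      have hcau : Cauchy (comap f (𝓝 y)) := by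
        refine Metric.cauchy_iff.2 ⟨hne, fun ε hε => ?_⟩
        obtain ⟨n, hn⟩ := exists_nat_one_div_lt hε
        obtain ⟨U, ⟨hU, hUd⟩, hyU⟩ := mem_sUnion.1 (mem_iInter.1 hyO n)
        exact ⟨f ⁻¹' U, preimage_mem_comap (hU.mem_nhds hyU),
          fun a ha b hb => (hUd a b ha hb).trans hn⟩
      obtain ⟨x, hx⟩ := CompleteSpace.complete hcau
      have h1 : Tendsto f (comap f (𝓝 y)) (𝓝 y) := tendsto_comap
      have h2 : Tendsto f (comap f (𝓝 y)) (𝓝 (f x)) := (hf.continuous.tendsto x).mono_left hx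
      exact ⟨x, tendsto_nhds_unique h2 h1⟩
  rw [key]
  exact isClosed_closure.isGδ.inter (IsGδ.iInter_of_isOpen hO)

/-- The mass of an open set is a lower semicontinuous function of the measure. -/
theorem isOpen_setOf_lt_measure {X : Type*} [TopologicalSpace X] [MeasurableSpace X]
    [HasOuterApproxClosed X] [OpensMeasurableSpace X] {G : Set X} (hG : IsOpen G) (c : ENNReal) :
    IsOpen {μ : ProbabilityMeasure X | c < (μ : Measure X) G} := by
  refine isOpen_iff_mem_nhds.2 fun μ hμ => ?_
  exact eventually_lt_of_lt_liminf
    (lt_of_lt_of_le hμ (ProbabilityMeasure.le_liminf_measure_open_of_tendsto tendsto_id hG))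

section Pushforward

theorem measurableEmbedding_of_isEmbedding {X Y : Type*} [TopologicalSpace X] [PolishSpace X]
    [MeasurableSpace X] [BorelSpace X] [TopologicalSpace Y] [MetrizableSpace Y] [MeasurableSpace Y]
    [BorelSpace Y] {f : X → Y} (hf : IsEmbedding f) : MeasurableEmbedding f :=
  hf.measurableEmbedding (isGδ_range_of_isEmbedding hf).measurableSet

variable {X Y : Type*} [TopologicalSpace X] [PolishSpace X] [MeasurableSpace X] [BorelSpace X]
  [TopologicalSpace Y] [MetrizableSpace Y] [MeasurableSpace Y]
  [BorelSpace Y] {f : X → Y}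

/-- Pushing probability measures forward along an embedding is an embedding. -/
theorem isEmbedding_probabilityMeasure_map [SecondCountableTopology Y] (hf : IsEmbedding f) :
    IsEmbedding fun μ : ProbabilityMeasure X => μ.map hf.continuous.measurable.aemeasurable := by
  have hm := measurableEmbedding_of_isEmbedding hf
  refine ⟨isInducing_iff_nhds.2 fun μ => le_antisymm
    (ProbabilityMeasure.continuous_map hf.continuous).continuousAt.le_comap ?_, fun μ ν h => ?_⟩
  · refine tendsto_id'.1 (tendsto_of_forall_isOpen_le_liminf' fun G hG => ?_)
    obtain ⟨H, hH, rfl⟩ := hf.isInducing.isOpen_iff.1 hG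
    have := ProbabilityMeasure.le_liminf_measure_open_of_tendsto
      (tendsto_comap (f := fun μ : ProbabilityMeasure X =>
        μ.map hf.continuous.measurable.aemeasurable)
        (x := 𝓝 (μ.map hf.continuous.measurable.aemeasurable))) hH
    simpa only [ProbabilityMeasure.toMeasure_map, hm.map_apply, id] using this
  · refine ProbabilityMeasure.toMeasure_injective ?_
    have h' : (μ : Measure X).map f = (ν : Measure X).map f :=
      congrArg (fun ρ : ProbabilityMeasure Y => (ρ : Measure Y)) h
    rw [← hm.comap_map (μ : Measure X), h', hm.comap_map]

/-- The image consists of the measures giving full mass to the Gδ set `range f`. Full mass of each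
open `G n` is a countable intersection of conditions `1 - 1/(k+1) < ν (G n)`, open by lower
semicontinuity. -/
theorem isGδ_range_probabilityMeasure_map (hf : IsEmbedding f) :
    IsGδ (range fun μ : ProbabilityMeasure X =>
      μ.map hf.continuous.measurable.aemeasurable) := by
  have hm := measurableEmbedding_of_isEmbedding hf
  obtain ⟨G, hG, hGf⟩ := isGδ_iff_eq_iInter_nat.1 (isGδ_range_of_isEmbedding hf)
  have key : (range fun μ : ProbabilityMeasure X =>
      μ.map hf.continuous.measurable.aemeasurable) =
      ⋂ n, ⋂ k : ℕ, {ν : ProbabilityMeasure Y | 1 - ((k : ENNReal) + 1)⁻¹ < (ν : Measure Y) (G n)} := by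
    ext ν
    simp only [mem_range, mem_iInter, mem_ofPred_eq]
    constructor
    · rintro ⟨μ, rfl⟩ n k
      have : f ⁻¹' (G n) = univ := by
        refine eq_univ_of_forall fun x => ?_
        have : f x ∈ ⋂ n, G n := hGf ▸ mem_range_self x
        exact mem_iInter.1 this n
      rw [ProbabilityMeasure.toMeasure_map, hm.map_apply, this, measure_univ]
      exact ENNReal.sub_lt_self (by simp) (by simp) (by simp)
    · intro h
      have hG1 : ∀ n, (ν : Measure Y) (G n)ᶜ = 0 := fun n => by
        rw [prob_compl_eq_zero_iff (hG n).measurableSet]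
        refine le_antisymm prob_le_one (ENNReal.le_of_forall_pos_le_add fun ε hε _ => ?_)
        obtain ⟨k, hk⟩ := ENNReal.exists_inv_nat_lt (a := (ε : ENNReal)) (by simpa using hε.ne')
        have h1 : ((k : ENNReal) + 1)⁻¹ ≤ ε :=
          (ENNReal.inv_le_inv.2 le_self_add).trans hk.le
        exact (tsub_le_iff_right.1 (h n k).le).trans (by gcongr)
      have hrange : ∀ᵐ y ∂(ν : Measure Y), y ∈ range f := by
        rw [hGf]
        simp only [mem_iInter]
        exact ae_all_iff.2 fun n => hG1 n
      have hmap : ((ν : Measure Y).comap f).map f = ν := by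
        rw [hm.map_comap, Measure.restrict_eq_self_of_ae_mem hrange]
      have hprob : IsProbabilityMeasure ((ν : Measure Y).comap f) := by
        refine ⟨?_⟩
        rw [← preimage_univ (f := f), ← hm.map_apply, hmap, measure_univ]
      exact ⟨⟨(ν : Measure Y).comap f, hprob⟩, ProbabilityMeasure.toMeasure_injective hmap⟩
  rw [key]
  exact .iInter fun n => .iInter fun k => (isOpen_setOf_lt_measure (hG n) _).isGδ

end Pushforward

/-- A closed set of probability measures on a Polish space is a Baire space. -/
theorem baireSpace_of_isClosed_probabilityMeasure {X : Type*} [TopologicalSpace X] [PolishSpace X]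
    [MeasurableSpace X] [BorelSpace X] {S : Set (ProbabilityMeasure X)} (hS : IsClosed S) :
    BaireSpace S := by
  let := upgradeIsCompletelyMetrizable X
  obtain ⟨f, hf⟩ := Metric.PiNatEmbed.exists_embedding_to_hilbert_cube (X := X)
  have hΦ := isEmbedding_probabilityMeasure_map hf
  have hg := hΦ.comp (IsEmbedding.subtypeVal (p := (· ∈ S)))
  obtain ⟨C, hC, hCS⟩ := hΦ.isInducing.isClosed_iff.1 hS
  have hrange : IsGδ (range ((fun μ : ProbabilityMeasure X =>
      μ.map hf.continuous.measurable.aemeasurable) ∘ (Subtype.val : S → ProbabilityMeasure X))) := by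
    rw [range_comp, Subtype.range_coe, ← hCS, image_preimage_eq_inter_range]
    exact hC.isGδ.inter (isGδ_range_probabilityMeasure_map hf)
  -- Probability measures on the Hilbert cube form a compact Hausdorff space, whose Gδ subsets are
  -- Baire.
  have := hrange.baireSpace_of_t2Space_locallyCompactSpace
  exact hg.toHomeomorph.symm.baireSpace

end BaireMeasures


/-! ### Periodic orbit measures and their ergodicity -/

section Periodic

variable {X : Type*} [TopologicalSpace X]

theorem continuous_orbit (φ : Flow ℝ X) (x : X) : Continuous fun s : ℝ => φ s x :=
  φ.continuous continuous_id continuous_const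

theorem continuous_flow (φ : Flow ℝ X) (t : ℝ) : Continuous (φ t) :=
  φ.continuous continuous_const continuous_id

theorem periodic_orbit {φ : Flow ℝ X} {x : X} {l : ℝ} (hx : φ l x = x) :
    Function.Periodic (fun s : ℝ => φ s x) l := fun s => by
  simp only [φ.map_add, hx]

theorem integral_flow_add_periodic {φ : Flow ℝ X} {x : X} {l : ℝ} (hx : φ l x = x) (f : X → ℝ)
    (t : ℝ) : ∫ s in (0 : ℝ)..l, f (φ (t + s) x) = ∫ s in (0 : ℝ)..l, f (φ s x) := by
  rw [intervalIntegral.integral_comp_add_left (fun s => f (φ s x)) t, add_zero]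
  have hp : Function.Periodic (fun s : ℝ => f (φ s x)) l := (periodic_orbit hx).comp f
  simpa using hp.intervalIntegral_add_eq t 0

variable [MeasurableSpace X]

/-- The sets tested are invariant only up to a null set depending on `t`. Level sets of an `L²`
function fixed by the flow have exactly this property. -/
theorem isErgodic_iff [BorelSpace X] (φ : Flow ℝ X) (μ : ProbabilityMeasure X) :
    IsErgodic φ μ ↔ μ ∈ invariantMeasures φ ∧ ∀ s, MeasurableSet s →
      (∀ t : ℝ, φ t ⁻¹' s =ᵐ[(μ : Measure X)] s) →
        (μ : Measure X) s = 0 ∨ (μ : Measure X) sᶜ = 0 := by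
  have hconst : ∀ s : Set X, EventuallyConst s (ae (μ : Measure X)) ↔
      (μ : Measure X) s = 0 ∨ (μ : Measure X) sᶜ = 0 := fun s => by
    rw [eventuallyConst_set', ae_eq_empty, ae_eq_univ]
  let := φ.toAddAction
  unfold IsErgodic
  rw [ergodicVAdd_iff]
  constructor
  · rintro ⟨h, h'⟩
    have hm : ∀ t : ℝ, Measurable (φ t) := fun t => (continuous_flow φ t).measurable
    refine ⟨fun t => ⟨hm t, Measure.ext fun s hs => ?_⟩, fun s hs hs' => (hconst s).1 (h' hs hs')⟩
    rw [Measure.map_apply (hm t) hs]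
    exact h.measure_preimage_vadd t hs
  · rintro ⟨h, h'⟩
    exact ⟨⟨fun t s hs => (h t).measure_preimage hs.nullMeasurableSet⟩,
      fun {s} hs hs' => (hconst s).2 (h' s hs hs')⟩

/-- The invariant probability measures carried by periodic orbits. -/
def periodicMeasures (φ : Flow ℝ X) : Set (ProbabilityMeasure X) :=
  {μ | ∃ (x : X) (l : ℝ), 0 < l ∧ φ l x = x ∧
    (μ : Measure X) = ENNReal.ofReal l⁻¹ • (volume.restrict (Ioc 0 l)).map fun s => φ s x}

variable [BorelSpace X]

theorem exists_periodicMeasure (φ : Flow ℝ X) (x : X) {l : ℝ} (hl : 0 < l) :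
    ∃ μ : ProbabilityMeasure X, (μ : Measure X) =
      ENNReal.ofReal l⁻¹ • (volume.restrict (Ioc 0 l)).map fun s => φ s x := by
  refine ⟨⟨ENNReal.ofReal l⁻¹ • (volume.restrict (Ioc 0 l)).map fun s => φ s x, ⟨?_⟩⟩, rfl⟩
  rw [Measure.smul_apply, Measure.map_apply (continuous_orbit φ x).measurable .univ, preimage_univ,
    Measure.restrict_apply_univ, Real.volume_Ioc, sub_zero, smul_eq_mul,
    ← ENNReal.ofReal_mul (by positivity), inv_mul_cancel₀ hl.ne', ENNReal.ofReal_one]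

theorem integral_periodicMeasure {φ : Flow ℝ X} {x : X} {l : ℝ} (hl : 0 < l) {μ : Measure X}
    (hμ : μ = ENNReal.ofReal l⁻¹ • (volume.restrict (Ioc 0 l)).map fun s => φ s x)
    {f : X → ℝ} (hf : StronglyMeasurable f) :
    ∫ y, f y ∂μ = l⁻¹ * ∫ s in (0 : ℝ)..l, f (φ s x) := by
  rw [hμ, integral_smul_measure, integral_map (continuous_orbit φ x).measurable.aemeasurable
    hf.aestronglyMeasurable, intervalIntegral.integral_of_le hl.le,
    ENNReal.toReal_ofReal (by positivity), smul_eq_mul]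

theorem periodicMeasures_subset_invariantMeasures [HasOuterApproxClosed X] (φ : Flow ℝ X) :
    periodicMeasures φ ⊆ invariantMeasures φ := by
  rintro μ ⟨x, l, hl, hx, hμ⟩ t
  have hφ := continuous_flow φ t
  refine ⟨hφ.measurable, ?_⟩
  have := Measure.isProbabilityMeasure_map (μ := (μ : Measure X)) hφ.measurable.aemeasurable
  refine ext_of_forall_integral_eq_of_IsFiniteMeasure fun f => ?_
  have hf : StronglyMeasurable f := f.continuous.measurable.stronglyMeasurable
  rw [integral_map hφ.measurable.aemeasurable hf.aestronglyMeasurable,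
    integral_periodicMeasure hl hμ hf,
    integral_periodicMeasure (f := fun y => f (φ t y)) hl hμ (hf.comp_measurable hφ.measurable)]
  simp only [← φ.map_add, integral_flow_add_periodic hx f t]

/-- Let `J` be the time spent in `A` over a period `l`. For each `t`, invariance of `A` gives `∫ χ(φ
s x) χ(φ (t + s) x) ds = J`. Integrating over `t` and applying Fubini yields `J * J = l * J`, so `J`
is `0` or `l`; no common null set for all `t` is needed. -/
theorem isErgodic_of_mem_periodicMeasures [HasOuterApproxClosed X] {φ : Flow ℝ X}
    {μ : ProbabilityMeasure X} (hμ : μ ∈ periodicMeasures φ) : IsErgodic φ μ := by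
  refine (isErgodic_iff φ μ).2 ⟨periodicMeasures_subset_invariantMeasures φ hμ, fun A hA hAt => ?_⟩
  obtain ⟨x, l, hl, hx, hμ⟩ := hμ
  let χ : X → ℝ := A.indicator 1
  have hχ : StronglyMeasurable χ := stronglyMeasurable_one.indicator hA
  have hχ_le : ∀ y, ‖χ y‖ ≤ 1 := fun y => by
    by_cases hy : y ∈ A <;> simp [χ, hy]
  have hχm : Measurable fun s : ℝ => χ (φ s x) :=
    hχ.measurable.comp (continuous_orbit φ x).measurable
  let J : ℝ := ∫ s in (0 : ℝ)..l, χ (φ s x)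
  have hJ : (μ : Measure X).real A = l⁻¹ * J := by
    rw [← integral_indicator_one hA]
    exact integral_periodicMeasure hl hμ hχ
  have h1 : ∀ t : ℝ, ∫ s in (0 : ℝ)..l, χ (φ s x) * χ (φ (t + s) x) = J := by
    intro t
    have hm : StronglyMeasurable fun y => χ y * χ (φ t y) :=
      hχ.mul (hχ.comp_measurable (continuous_flow φ t).measurable)
    have h2 := integral_periodicMeasure hl hμ hm
    have h3 := integral_periodicMeasure hl hμ hχ
    have h4 : ∫ y, χ y * χ (φ t y) ∂(μ : Measure X) = ∫ y, χ y ∂(μ : Measure X) := by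
      refine integral_congr_ae ?_
      filter_upwards [(hAt t).mem_iff] with y hy
      have hy' : φ t y ∈ A ↔ y ∈ A := hy
      by_cases h : y ∈ A
      · simp [χ, h, hy'.2 h]
      · simp [χ, h]
    rw [h2, h3] at h4
    have h5 := mul_left_cancel₀ (inv_ne_zero hl.ne') h4
    simpa only [φ.map_add] using h5
  have hsq : J * J = l * J := by
    have hint : Integrable (Function.uncurry fun t s : ℝ => χ (φ s x) * χ (φ (t + s) x))
        ((volume.restrict (Ioc 0 l)).prod (volume.restrict (Ioc 0 l))) := by
      refine Integrable.of_bound (C := 1) ?_ (Eventually.of_forall fun p => ?_)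
      · exact ((hχm.comp measurable_snd).mul
          (hχm.comp (measurable_fst.add measurable_snd))).aestronglyMeasurable
      · simp only [Function.uncurry, norm_mul]
        exact mul_le_one₀ (hχ_le _) (norm_nonneg _) (hχ_le _)
    have hswap := integral_integral_swap hint
    simp only [← intervalIntegral.integral_of_le hl.le] at hswap
    simp only [h1, intervalIntegral.integral_const, sub_zero, smul_eq_mul,
      intervalIntegral.integral_const_mul] at hswap
    rw [hswap]
    have h6 : ∀ s : ℝ, ∫ t in (0 : ℝ)..l, χ (φ (t + s) x) = J := fun s => by
      simp only [add_comm _ s]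
      exact integral_flow_add_periodic hx χ s
    simp only [h6, intervalIntegral.integral_mul_const, J]
  rcases mul_eq_mul_right_iff.1 hsq with h | h
  · right
    rw [prob_compl_eq_zero_iff hA]
    rw [h, inv_mul_cancel₀ hl.ne'] at hJ
    have := (ENNReal.toReal_eq_one_iff _).1 hJ
    exact this
  · left
    rw [h, mul_zero] at hJ
    exact (measureReal_eq_zero_iff).1 hJ

end Periodic


/-! ### Ergodicity is a Gδ condition -/

section ErgodicGdelta

open TopologicalSpace BoundedContinuousFunction

/-- There are countably many bounded continuous functions whose integrals determine a finite
Borel measure of given total mass. -/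
theorem exists_countable_separating_integrals (X : Type*) [TopologicalSpace X]
    [SecondCountableTopology X] [HasOuterApproxClosed X] [MeasurableSpace X] [BorelSpace X] :
    ∃ F : Set (BoundedContinuousFunction X ℝ), F.Countable ∧
      ∀ (μ ν : Measure X) [IsFiniteMeasure μ] [IsFiniteMeasure ν], μ univ = ν univ →
        (∀ f ∈ F, ∫ x, f x ∂μ = ∫ x, f x ∂ν) → μ = ν := by
  let C : Set (Set X) := (fun f => ⋂₀ f) '' {f | f.Finite ∧ f ⊆ countableBasis X}
  have hCb : IsTopologicalBasis C :=
    isTopologicalBasis_of_subbasis (isBasis_countableBasis X).eq_generateFrom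
  have hCc : C.Countable := (countable_ofPred_finite_subset (countable_countableBasis X)).image _
  have hCpi : IsPiSystem C := by
    rintro _ ⟨f, ⟨hf, hf'⟩, rfl⟩ _ ⟨g, ⟨hg, hg'⟩, rfl⟩ -
    exact ⟨f ∪ g, ⟨hf.union hg, union_subset hf' hg'⟩, sInter_union f g⟩
  -- Continuous functions decreasing to the indicator of the closed set `Uᶜ` recover its mass; for
  -- `U` in the countable π-system `C` this determines the measure.
  have happ : ∀ U : Set X, ∃ f : ℕ → BoundedContinuousFunction X ℝ, IsOpen U →
      ∀ (μ : Measure X) [IsFiniteMeasure μ],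
        Tendsto (fun n => ∫ x, f n x ∂μ) atTop (𝓝 (μ.real Uᶜ)) := by
    intro U
    by_cases hU : IsOpen U
    · refine ⟨fun n => (hU.isClosed_compl.apprSeq n).comp _ NNReal.isometry_coe.lipschitz,
        fun _ μ _ => ?_⟩
      have h1 := HasOuterApproxClosed.tendsto_lintegral_apprSeq hU.isClosed_compl μ
      have h2 := (ENNReal.tendsto_toReal (measure_ne_top μ Uᶜ)).comp h1
      refine h2.congr fun n => ?_
      exact toReal_lintegral_coe_eq_integral _ μ
    · exact ⟨fun _ => 0, fun h => absurd h hU⟩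
  choose f hf using happ
  refine ⟨⋃ U ∈ C, range (f U), hCc.biUnion fun U _ => countable_range _,
    fun μ ν _ _ huniv hμν => ?_⟩
  refine ext_of_generate_finite C ?_ hCpi (fun U hU => ?_) huniv
  · rw [BorelSpace.measurable_eq (α := X), hCb.borel_eq_generateFrom]
  · have hUo : IsOpen U := hCb.isOpen hU
    have h1 : μ.real Uᶜ = ν.real Uᶜ := by
      refine tendsto_nhds_unique (hf U hUo μ) ((hf U hUo ν).congr fun n => ?_)
      exact (hμν _ (mem_iUnion₂.2 ⟨U, hU, n, rfl⟩)).symm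
    have h2 : μ Uᶜ = ν Uᶜ :=
      (ENNReal.toReal_eq_toReal_iff' (measure_ne_top _ _) (measure_ne_top _ _)).1 h1
    have h3 := measure_compl (μ := μ) hUo.measurableSet.compl (measure_ne_top _ _)
    have h4 := measure_compl (μ := ν) hUo.measurableSet.compl (measure_ne_top _ _)
    rw [compl_compl] at h3 h4
    rw [h3, h4, h2, huniv]

/-- A family of linear isometries of a Hilbert space that preserves a nonempty set has a common
fixed point in the closed convex hull of this set. -/
theorem exists_fixed_point_closure_convexHull {E ι : Type*} [NormedAddCommGroup E]
    [InnerProductSpace ℝ E] [CompleteSpace E] (T : ι → E →ₗᵢ[ℝ] E) {O : Set E} (hO : O.Nonempty)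
    (hT : ∀ i, MapsTo (T i) O O) :
    ∃ h ∈ closure (convexHull ℝ O), ∀ i, T i h = h := by
  have hconv : Convex ℝ (closure (convexHull ℝ O)) := (convex_convexHull ℝ O).closure
  have hne : (closure (convexHull ℝ O)).Nonempty := hO.convexHull.closure
  have hmaps : ∀ i, MapsTo (T i) (closure (convexHull ℝ O)) (closure (convexHull ℝ O)) := by
    intro i
    refine MapsTo.closure (fun x hx => ?_) (T i).continuous
    have h1 : T i x ∈ (T i).toLinearMap '' convexHull ℝ O := mem_image_of_mem _ hx
    rw [LinearMap.image_convexHull] at h1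
    exact convexHull_mono (hT i).image_subset h1
  -- The fixed point is the unique element of minimal norm: `T i h` lies in the same convex set and
  -- has the same norm.
  obtain ⟨h, hh, hmin⟩ := exists_norm_eq_iInf_of_complete_convex hne isClosed_closure.isComplete
    hconv 0
  refine ⟨h, hh, fun i => ?_⟩
  have hinner := (norm_eq_iInf_iff_real_inner_le_zero hconv hh).1 hmin (T i h) (hmaps i hh)
  have hnorm : ‖T i h‖ = ‖h‖ := (T i).norm_map h
  have hsub : ‖T i h - h‖ * ‖T i h - h‖ ≤ 0 := by
    rw [← real_inner_self_eq_norm_mul_norm]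
    rw [zero_sub, inner_neg_left, inner_sub_right] at hinner
    have e : inner ℝ (T i h - h) (T i h - h) =
        ‖T i h‖ * ‖T i h‖ - ‖h‖ * ‖h‖ - 2 * (inner ℝ h (T i h) - inner ℝ h h) := by
      rw [← real_inner_self_eq_norm_mul_norm, ← real_inner_self_eq_norm_mul_norm]
      simp only [inner_sub_left, inner_sub_right, real_inner_comm h (T i h)]
      ring
    rw [e, hnorm]
    linarith
  have : ‖T i h - h‖ = 0 := by nlinarith [norm_nonneg (T i h - h)]
  exact sub_eq_zero.1 (norm_eq_zero.1 this)

/-- Full support can be tested on a countable basis. -/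
theorem setOf_hasFullSupport_eq {X : Type*} [TopologicalSpace X]
    [SecondCountableTopology X] [MeasurableSpace X] (M : Set (ProbabilityMeasure X)) :
    {μ : M | HasFullSupport μ.1} =
      ⋂ U ∈ countableBasis X, {μ : M | 0 < (μ.1 : Measure X) U} := by
  ext μ
  simp only [mem_ofPred_eq, mem_iInter]
  constructor
  · intro h U hU
    have : (μ.1 : Measure X).IsOpenPosMeasure := h
    exact (isOpen_of_mem_countableBasis hU).measure_pos _ (nonempty_of_mem_countableBasis hU)
  · intro h
    refine ⟨fun U hU ⟨x, hx⟩ => ?_⟩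
    obtain ⟨V, hV, -, hVU⟩ := (isBasis_countableBasis X).exists_subset_of_mem_open hx hU
    exact ((h V hV).trans_le (measure_mono hVU)).ne'

variable {X : Type*} [TopologicalSpace X]

/-- The orbit of a bounded continuous function under a flow. -/
def functionOrbit (φ : Flow ℝ X) (f : BoundedContinuousFunction X ℝ) :
    Set (BoundedContinuousFunction X ℝ) :=
  range fun t : ℝ => f.compContinuous ⟨φ t, continuous_flow φ t⟩

variable [MeasurableSpace X] [BorelSpace X]

/-- For an ergodic measure, the integral of a function is an `L²` limit of convex combinations of
its translates under the flow. -/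
theorem IsErgodic.exists_convexHull_integral_sq_lt {φ : Flow ℝ X} {μ : ProbabilityMeasure X}
    (hμ : IsErgodic φ μ) (f : BoundedContinuousFunction X ℝ) {ε : ℝ} (hε : 0 < ε) :
    ∃ g ∈ convexHull ℝ (functionOrbit φ f),
      ∫ x, g x ^ 2 ∂(μ : Measure X) - (∫ x, f x ∂(μ : Measure X)) ^ 2 < ε := by
  obtain ⟨hinv, herg⟩ := (isErgodic_iff φ μ).1 hμ
  let m : Measure X := μ
  let T : ℝ → Lp ℝ 2 m →ₗᵢ[ℝ] Lp ℝ 2 m := fun t => Lp.compMeasurePreservingₗᵢ ℝ (φ t) (hinv t)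
  let J : BoundedContinuousFunction X ℝ →L[ℝ] Lp ℝ 2 m := BoundedContinuousFunction.toLp 2 m ℝ
  have hJ : ∀ u, J u =ᵐ[m] u := fun u => BoundedContinuousFunction.coeFn_toLp 2 m ℝ u
  have hTh : ∀ t u, T t u =ᵐ[m] u ∘ φ t := fun t u => Lp.coeFn_compMeasurePreserving u (hinv t)
  have hne : (J '' functionOrbit φ f).Nonempty := (range_nonempty _).image _
  have hmaps : ∀ t, MapsTo (T t) (J '' functionOrbit φ f) (J '' functionOrbit φ f) := by
    rintro t _ ⟨_, ⟨s, rfl⟩, rfl⟩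
    refine ⟨_, ⟨s + t, rfl⟩, Lp.ext ?_⟩
    refine (hJ _).trans (EventuallyEq.trans ?_ (hTh t _).symm)
    filter_upwards [(hinv t).quasiMeasurePreserving.ae_eq_comp
      (hJ (f.compContinuous ⟨φ s, continuous_flow φ s⟩))] with x hx
    rw [hx]
    simp [φ.map_add]
  obtain ⟨h, hh, hfix⟩ := exists_fixed_point_closure_convexHull T hne hmaps
  have hmeas : Measurable h := (Lp.stronglyMeasurable h).measurable
  -- Preimages under the fixed vector `h` are almost invariant sets, so ergodicity makes `h`
  -- constant.
  obtain ⟨c, hc⟩ : ∃ c : ℝ, h =ᵐ[m] Function.const X c := by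
    refine exists_eventuallyEq_const_of_forall_separating MeasurableSet fun U hU => ?_
    have hA := herg (h ⁻¹' U) (hmeas hU) fun t => ?_
    · rcases hA with hA | hA
      · exact Or.inr (measure_eq_zero_iff_ae_notMem.1 hA)
      · exact Or.inl hA
    · have h1 : h ∘ φ t =ᵐ[m] h := by
        have := hTh t h
        rw [hfix t] at this
        exact this.symm
      exact h1.preimage U
  -- The integral is continuous and linear on `L²` and constant on the orbit of `f`, hence on the
  -- closed convex hull. This identifies the constant `c`.
  have hclosed : closure (convexHull ℝ (J '' functionOrbit φ f)) ⊆
      {u : Lp ℝ 2 m | ∫ x, u x ∂m = ∫ x, f x ∂m} := by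
    have hlin : ∀ u : Lp ℝ 2 m, ∫ x, u x ∂m =
        inner ℝ (indicatorConstLp 2 MeasurableSet.univ (measure_ne_top m univ) (1 : ℝ)) u := by
      intro u
      rw [L2.inner_indicatorConstLp_one, setIntegral_univ]
    refine closure_minimal (convexHull_min ?_ ?_) ?_
    · rintro _ ⟨_, ⟨t, rfl⟩, rfl⟩
      have h1 := (hinv t).map_eq
      have h2 := integral_map (μ := m) (hinv t).measurable.aemeasurable (f := f)
        f.continuous.measurable.aestronglyMeasurable
      rw [h1] at h2
      exact (integral_congr_ae (hJ _)).trans h2.symm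
    · intro u hu v hv a b _ _ hab
      simp only [mem_ofPred_eq, hlin] at hu hv ⊢
      rw [inner_add_right, inner_smul_right, inner_smul_right, hu, hv, ← add_mul, hab, one_mul]
    · simp only [hlin]
      exact isClosed_eq (continuous_const.inner continuous_id) continuous_const
  have hcf : c = ∫ x, f x ∂m := by
    rw [← hclosed hh, integral_congr_ae hc]
    simp
  have hhc : inner ℝ h h = c ^ 2 := by
    rw [L2.inner_def, integral_congr_ae (g := fun _ => c ^ 2)]
    · simp
    · filter_upwards [hc] with x hx
      simp [hx, sq]
  have himage : J '' convexHull ℝ (functionOrbit φ f) = convexHull ℝ (J '' functionOrbit φ f) :=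
    J.toLinearMap.image_convexHull _
  rw [← himage] at hh
  have hopen : IsOpen {u : Lp ℝ 2 m | inner ℝ u u < c ^ 2 + ε} :=
    isOpen_lt (continuous_id.inner continuous_id) continuous_const
  obtain ⟨_, hu, g, hg, rfl⟩ := mem_closure_iff.1 hh _ hopen (by
    simp only [mem_ofPred_eq, hhc]; linarith)
  refine ⟨g, hg, ?_⟩
  have hgg : inner ℝ (J g) (J g) = ∫ x, g x ^ 2 ∂m := by
    rw [L2.inner_def]
    refine integral_congr_ae ?_
    filter_upwards [hJ g] with x hx
    simp [hx, sq]
  have hu' : inner ℝ (J g) (J g) < c ^ 2 + ε := hu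
  rw [hgg, hcf] at hu'
  change ∫ x, g x ^ 2 ∂m - (∫ x, f x ∂m) ^ 2 < ε
  linarith

/-- A criterion for ergodicity in terms of the integrals of countably many functions. -/
theorem isErgodic_of_forall_exists_convexHull {φ : Flow ℝ X} {μ : ProbabilityMeasure X}
    (hμ : μ ∈ invariantMeasures φ) {F : Set (BoundedContinuousFunction X ℝ)}
    (hF : ∀ (μ ν : Measure X) [IsFiniteMeasure μ] [IsFiniteMeasure ν], μ univ = ν univ →
        (∀ f ∈ F, ∫ x, f x ∂μ = ∫ x, f x ∂ν) → μ = ν)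
    (h : ∀ f ∈ F, ∀ ε : ℝ, 0 < ε → ∃ g ∈ convexHull ℝ (functionOrbit φ f),
      ∫ x, g x ^ 2 ∂(μ : Measure X) - (∫ x, f x ∂(μ : Measure X)) ^ 2 < ε) :
    IsErgodic φ μ := by
  refine (isErgodic_iff φ μ).2 ⟨hμ, fun A hA hAt => ?_⟩
  have hint : ∀ (f : BoundedContinuousFunction X ℝ) (ν : Measure X) [IsFiniteMeasure ν],
      Integrable f ν := fun f ν _ => f.integrable ν
  have hinv : ∀ (B : Set X), MeasurableSet B → (∀ t : ℝ, φ t ⁻¹' B =ᵐ[(μ : Measure X)] B) →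
      ∀ f : BoundedContinuousFunction X ℝ, ∀ g ∈ convexHull ℝ (functionOrbit φ f),
      ∫ x in B, g x ∂(μ : Measure X) = ∫ x in B, f x ∂(μ : Measure X) := by
    intro B hB hBt f g hg
    have hsub : convexHull ℝ (functionOrbit φ f) ⊆ {g : BoundedContinuousFunction X ℝ |
        ∫ x in B, g x ∂(μ : Measure X) = ∫ x in B, f x ∂(μ : Measure X)} := by
      refine convexHull_min ?_ ?_
      · rintro _ ⟨t, rfl⟩
        have h1 : ∫ x in B, f (φ t x) ∂(μ : Measure X) =
            ∫ x in φ t ⁻¹' B, f (φ t x) ∂(μ : Measure X) := setIntegral_congr_set (hBt t).symm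
        have h2 := setIntegral_map (μ := (μ : Measure X)) hB (g := φ t) (f := f)
          f.continuous.measurable.aestronglyMeasurable (hμ t).measurable.aemeasurable
        rw [(hμ t).map_eq] at h2
        exact h1.trans h2.symm
      · intro u hu v hv a b _ _ hab
        simp only [mem_ofPred_eq, coe_add, coe_smul, Pi.add_apply, smul_eq_mul] at hu hv ⊢
        rw [integral_add ((hint u _).const_mul a) ((hint v _).const_mul b),
          integral_const_mul, integral_const_mul, hu, hv, ← add_mul, hab, one_mul]
    exact hsub hg
  have hkey : ∀ f ∈ F, ∫ x in A, f x ∂(μ : Measure X) =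
      (μ : Measure X).real A * ∫ x, f x ∂(μ : Measure X) := by
    intro f hf
    refine eq_of_abs_sub_le_all fun δ hδ => ?_
    set c := ∫ x, f x ∂(μ : Measure X) with hc
    -- Chosen for the bound `|y| ≤ δ/2 + (2/δ) y²`: a variance below `(δ/2)²` gives an `L¹` distance
    -- from `g` to `c` of at most `δ`.
    obtain ⟨g, hg, hlt⟩ := h f hf ((δ / 2) ^ 2) (by positivity)
    have hgA := hinv A hA hAt f g hg
    have hgX : ∫ x, g x ∂(μ : Measure X) = c := by
      simpa using hinv univ .univ (fun t => by simp) f g hg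
    have hint2 : Integrable (fun x => g x ^ 2) (μ : Measure X) := by
      simp only [sq]
      exact hint (g * g) _
    have hintd : Integrable (fun x => (g x - c) ^ 2) (μ : Measure X) := by
      simp only [sq]
      exact hint ((g - const X c) * (g - const X c)) _
    have hvar : ∫ x, (g x - c) ^ 2 ∂(μ : Measure X) =
        ∫ x, g x ^ 2 ∂(μ : Measure X) - c ^ 2 := by
      have e : ∀ x, (g x - c) ^ 2 = g x ^ 2 - (2 * c * g x - c ^ 2) := fun x => by ring
      have hi : Integrable (fun x => 2 * c * g x - c ^ 2) (μ : Measure X) :=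
        ((hint g _).const_mul _).sub (integrable_const _)
      simp only [e]
      rw [integral_sub hint2 hi,
        integral_sub ((hint g _).const_mul _) (integrable_const _), integral_const_mul, hgX]
      simp
      ring
    have habs : Integrable (fun x => |g x - c|) (μ : Measure X) :=
      ((hint g _).sub (integrable_const c)).abs
    calc |∫ x in A, f x ∂(μ : Measure X) - (μ : Measure X).real A * c|
        = |∫ x in A, (g x - c) ∂(μ : Measure X)| := by
          rw [integral_sub (hint g _) (integrable_const _), hgA]
          simp
      _ ≤ ∫ x in A, |g x - c| ∂(μ : Measure X) := abs_integral_le_integral_abs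
      _ ≤ ∫ x, |g x - c| ∂(μ : Measure X) :=
          setIntegral_le_integral habs (Eventually.of_forall fun x => abs_nonneg _)
      _ ≤ ∫ x, (δ / 2 + (2 / δ) * (g x - c) ^ 2) ∂(μ : Measure X) := by
          refine integral_mono habs ((integrable_const _).add (hintd.const_mul _)) fun x => ?_
          have h1 : 0 ≤ (2 / δ) * (|g x - c| - δ / 2) ^ 2 + |g x - c| := by positivity
          have h2 : (2 / δ) * (|g x - c| - δ / 2) ^ 2 + |g x - c| =
              δ / 2 + (2 / δ) * (g x - c) ^ 2 - |g x - c| := by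
            rw [sub_sq, sq_abs]
            field_simp
            ring
          simp only
          linarith
      _ = δ / 2 + (2 / δ) * (∫ x, g x ^ 2 ∂(μ : Measure X) - c ^ 2) := by
          rw [integral_add (integrable_const _) (hintd.const_mul _), integral_const_mul, hvar]
          simp
      _ ≤ δ / 2 + (2 / δ) * (δ / 2) ^ 2 := by gcongr
      _ = δ := by field_simp; ring
  -- The two measures agree on the separating family `F`. Evaluating on `Aᶜ` gives `μ A * μ Aᶜ = 0`.
  have hmeas : (μ : Measure X).restrict A = (μ : Measure X) A • (μ : Measure X) := by
    have : IsFiniteMeasure ((μ : Measure X) A • (μ : Measure X)) :=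
      Measure.smul_finite _ (measure_ne_top _ _)
    refine hF _ _ (by simp) fun f hf => ?_
    rw [hkey f hf, integral_smul_measure, smul_eq_mul]
    rfl
  have hAA : (μ : Measure X) A * (μ : Measure X) Aᶜ = 0 := by
    have := congrArg (fun ν : Measure X => ν Aᶜ) hmeas
    simpa [Measure.restrict_apply hA.compl] using this.symm
  exact mul_eq_zero.1 hAA

/-- The ergodic measures form a `Gδ` subset of the space of invariant probability measures. -/
theorem isGδ_setOf_isErgodic [HasOuterApproxClosed X] [SecondCountableTopology X] (φ : Flow ℝ X) :
    IsGδ {μ : invariantMeasures φ | IsErgodic φ μ.1} := by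
  obtain ⟨F, hFc, hF⟩ := exists_countable_separating_integrals X
  have key : {μ : invariantMeasures φ | IsErgodic φ μ.1} = ⋂ f ∈ F, ⋂ n : ℕ,
      ⋃ g ∈ convexHull ℝ (functionOrbit φ f), {μ : invariantMeasures φ |
        ∫ x, g x ^ 2 ∂(μ.1 : Measure X) - (∫ x, f x ∂(μ.1 : Measure X)) ^ 2 < 1 / ((n : ℝ) + 1)} := by
    ext μ
    simp only [mem_ofPred_eq, mem_iInter, mem_iUnion, exists_prop]
    refine ⟨fun h f _ n => h.exists_convexHull_integral_sq_lt f (by positivity), fun h =>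
      isErgodic_of_forall_exists_convexHull μ.2 hF fun f hf ε hε => ?_⟩
    obtain ⟨n, hn⟩ := exists_nat_one_div_lt hε
    obtain ⟨g, hg, hlt⟩ := h f hf n
    exact ⟨g, hg, hlt.trans hn⟩
  rw [key]
  refine .biInter hFc fun f _ => .iInter fun n => IsOpen.isGδ ?_
  refine isOpen_biUnion fun g _ => isOpen_lt ?_ continuous_const
  have h1 : ∀ u : BoundedContinuousFunction X ℝ,
      Continuous fun μ : invariantMeasures φ => ∫ x, u x ∂(μ.1 : Measure X) := fun u =>
    (ProbabilityMeasure.continuous_integral_boundedContinuousFunction u).comp continuous_subtype_val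
  have h2 : Continuous fun μ : invariantMeasures φ => ∫ x, g x ^ 2 ∂(μ.1 : Measure X) := by
    simpa [sq] using h1 (g * g)
  exact h2.sub ((h1 f).pow 2)

end ErgodicGdelta


/-! ### Nonnegativity on periodic orbits passes to invariant measures -/

section Closing

/-- A variant of the maximal ergodic theorem: if almost every point has a nonnegative Birkhoff sum,
then the integral is nonnegative. -/
theorem integral_nonneg_of_birkhoffSum_nonneg {X : Type*} [MeasurableSpace X] {μ : Measure X}
    [IsFiniteMeasure μ] {g : X → X} (hg : MeasurePreserving g μ μ) {h : X → ℝ} (hh : Measurable h)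
    {K : ℝ} (hK : ∀ x, |h x| ≤ K) (hpos : ∀ᵐ x ∂μ, ∃ n : ℕ, 0 ≤ birkhoffSum g h (n + 1) x) :
    0 ≤ ∫ x, h x ∂μ := by
  -- `m N` is the maximum of the Birkhoff sums of lengths `0` to `N`.
  let m : ℕ → X → ℝ := fun N => Nat.rec (fun _ => 0) (fun _ u x => max 0 (h x + u (g x))) N
  have hm0 : ∀ x, m 0 x = 0 := fun _ => rfl
  have hmS : ∀ N x, m (N + 1) x = max 0 (h x + m N (g x)) := fun _ _ => rfl
  have hnn : ∀ N x, 0 ≤ m N x := by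
    intro N x
    cases N with
    | zero => exact (hm0 x).ge
    | succ N => rw [hmS]; exact le_max_left _ _
  have hmeas : ∀ N, Measurable (m N) := by
    intro N
    induction N with
    | zero => exact measurable_const
    | succ N ih => exact measurable_const.max (hh.add (ih.comp hg.measurable))
  have hbound : ∀ N x, m N x ≤ N * K := by
    intro N
    induction N with
    | zero => intro x; simp [hm0]
    | succ N ih =>
      intro x
      have hK0 : 0 ≤ K := (abs_nonneg _).trans (hK x)
      rw [hmS]
      refine max_le (by positivity) ?_
      have := ih (g x)
      have := (abs_le.1 (hK x)).2
      push_cast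
      linarith
  have hmono1 : ∀ N x, m N x ≤ m (N + 1) x := by
    intro N
    induction N with
    | zero => intro x; rw [hm0]; exact hnn 1 x
    | succ N ih =>
      intro x
      rw [hmS, hmS (N + 1)]
      exact max_le_max le_rfl (add_le_add le_rfl (ih (g x)))
  have hmono : ∀ x, Monotone fun N => m N x := fun x => monotone_nat_of_le_succ fun N => hmono1 N x
  have hbirk : ∀ N x, birkhoffSum g h N x ≤ m N x := by
    intro N
    induction N with
    | zero => intro x; simp [hm0]
    | succ N ih =>
      intro x
      rw [birkhoffSum_succ', hmS]
      exact (add_le_add le_rfl (ih (g x))).trans (le_max_right _ _)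
  have hint : ∀ N, Integrable (m N) μ := fun N =>
    Integrable.of_bound (hmeas N).aestronglyMeasurable (N * K) (Eventually.of_forall fun x => by
      rw [Real.norm_eq_abs, abs_of_nonneg (hnn N x)]; exact hbound N x)
  -- By invariance and monotonicity of `m`, `D N` has nonnegative integral. It equals `max (-m N ∘
  -- g) h`, which is eventually `h` wherever some Birkhoff sum is nonnegative.
  let D : ℕ → X → ℝ := fun N x => m (N + 1) x - m N (g x)
  have hDeq : ∀ N x, D N x = max (-m N (g x)) (h x) := fun N x => by
    simp only [D, hmS]
    rw [← max_sub_sub_right]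
    congr 1 <;> ring
  have hDint : ∀ N, 0 ≤ ∫ x, D N x ∂μ := by
    intro N
    have hi : Integrable (fun x => m N (g x)) μ := hg.integrable_comp_of_integrable (hint N)
    have h1 : ∫ x, m N (g x) ∂μ = ∫ x, m N x ∂μ := by
      have := integral_map (μ := μ) hg.measurable.aemeasurable (f := m N)
        (hmeas N).aestronglyMeasurable
      rw [hg.map_eq] at this
      exact this.symm
    simp only [D]
    rw [integral_sub (hint (N + 1)) hi, h1]
    exact sub_nonneg.2 (integral_mono (hint N) (hint (N + 1)) (hmono1 N))
  have hlim : Tendsto (fun N => ∫ x, D N x ∂μ) atTop (𝓝 (∫ x, h x ∂μ)) := by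
    refine tendsto_integral_of_dominated_convergence (fun _ => K)
      (fun N => ((hmeas (N + 1)).sub ((hmeas N).comp hg.measurable)).aestronglyMeasurable)
      (integrable_const K) (fun N => Eventually.of_forall fun x => ?_) ?_
    · have h1 := abs_le.1 (hK x)
      have h2 := hnn N (g x)
      rw [Real.norm_eq_abs, hDeq, abs_le]
      exact ⟨h1.1.trans (le_max_right _ _),
        max_le (by linarith [(abs_nonneg _).trans (hK x)]) h1.2⟩
    · filter_upwards [hpos] with x ⟨n, hn⟩
      refine tendsto_const_nhds.congr' ?_
      filter_upwards [eventually_ge_atTop n] with N hN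
      rw [hDeq, max_eq_right]
      rw [birkhoffSum_succ'] at hn
      have h1 := hbirk n (g x)
      have h2 : m n (g x) ≤ m N (g x) := hmono (g x) hN
      linarith
  exact ge_of_tendsto' hlim hDint

variable {X : Type*} [MetricSpace X]

/-- Comparison of the integrals of a function along two orbit segments that stay close. -/
theorem abs_integral_orbit_sub_le {φ : Flow ℝ X} {f : X → ℝ} {B L ε l t : ℝ} (hfc : Continuous f)
    (hB : ∀ x, |f x| ≤ B) (hL0 : 0 ≤ L) (hL : ∀ x y, |f x - f y| ≤ L * dist x y)
    {x₀ x : X} (hl : 0 < l) (ht : 0 < t) (hlt : |l - t| < ε)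
    (hclose : ∀ s : ℝ, 0 < s → s < min t l → dist (φ s x₀) (φ s x) < ε) :
    |(∫ s in (0 : ℝ)..l, f (φ s x₀)) - ∫ s in (0 : ℝ)..t, f (φ s x)| ≤ L * ε * t + B * ε := by
  have hε : 0 < ε := (abs_nonneg _).trans_lt hlt
  have hB0 : 0 ≤ B := (abs_nonneg _).trans (hB x)
  have hc : ∀ (y : X) (a b : ℝ), IntervalIntegrable (fun s => f (φ s y)) volume a b :=
    fun y a b => (hfc.comp (continuous_orbit φ y)).intervalIntegrable a b
  set m := min t l with hm
  have hm0 : 0 < m := lt_min ht hl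
  have h1 : ‖∫ s in (0 : ℝ)..m, (f (φ s x₀) - f (φ s x))‖ ≤ L * ε * |m - 0| := by
    refine intervalIntegral.norm_integral_le_of_norm_le_const_ae ?_
    have : ∀ᵐ s : ℝ, s ≠ m := by simp [ae_iff, measure_singleton]
    filter_upwards [this] with s hs hs'
    rw [uIoc_of_le hm0.le] at hs'
    refine (hL _ _).trans (mul_le_mul_of_nonneg_left ?_ hL0)
    exact (hclose s hs'.1 (lt_of_le_of_ne hs'.2 hs)).le
  have h2 : ‖∫ s in m..l, f (φ s x₀)‖ ≤ B * |l - m| :=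
    intervalIntegral.norm_integral_le_of_norm_le_const fun s _ => hB _
  have h3 : ‖∫ s in m..t, f (φ s x)‖ ≤ B * |t - m| :=
    intervalIntegral.norm_integral_le_of_norm_le_const fun s _ => hB _
  -- One of the two tails is empty, so together they have length less than `ε`.
  have h4 : |l - m| + |t - m| = |l - t| := by
    rcases le_total t l with h | h
    · rw [hm, min_eq_left h]; simp
    · rw [hm, min_eq_right h]; simp [abs_sub_comm]
  rw [← intervalIntegral.integral_add_adjacent_intervals (hc x₀ 0 m) (hc x₀ m l),
    ← intervalIntegral.integral_add_adjacent_intervals (hc x 0 m) (hc x m t)]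
  rw [intervalIntegral.integral_sub (hc x₀ 0 m) (hc x 0 m), sub_zero, abs_of_pos hm0] at h1
  rw [Real.norm_eq_abs] at h1 h2 h3
  have h5 : L * ε * m ≤ L * ε * t := mul_le_mul_of_nonneg_left (min_le_left _ _) (by positivity)
  have h6 : B * |l - m| + B * |t - m| ≤ B * ε := by
    rw [← mul_add, h4]; exact mul_le_mul_of_nonneg_left hlt.le hB0
  rw [abs_le] at *
  constructor <;> linarith

theorem iterate_flow_one {Y : Type*} [TopologicalSpace Y] (φ : Flow ℝ Y) (n : ℕ) (x : Y) :
    (φ 1)^[n] x = φ n x := by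
  induction n with
  | zero => simp
  | succ n ih => rw [Function.iterate_succ_apply', ih, ← φ.map_add]; push_cast; rw [add_comm]

variable [SecondCountableTopology X] [MeasurableSpace X] [BorelSpace X]

/-- Fubini and invariance. Replacing `f` by its average over unit time turns Birkhoff sums of `φ 1`
into integrals along orbits. -/
theorem integral_integral_orbit {φ : Flow ℝ X} {f : X → ℝ} (hf : BoundedLipschitz f)
    {μ : ProbabilityMeasure X} (hμ : μ ∈ invariantMeasures φ) :
    ∫ x, (∫ s in (0 : ℝ)..1, f (φ s x)) ∂(μ : Measure X) = ∫ x, f x ∂(μ : Measure X) := by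
  obtain ⟨B, L, hB0, hL0, hB, hL⟩ := id hf
  have hcont : Continuous fun p : X × ℝ => f (φ p.2 p.1) :=
    hf.continuous.comp (φ.continuous continuous_snd continuous_fst)
  have hint : Integrable (Function.uncurry fun (x : X) (s : ℝ) => f (φ s x))
      ((μ : Measure X).prod (volume.restrict (Ioc 0 1))) :=
    Integrable.of_bound hcont.aestronglyMeasurable B (Eventually.of_forall fun p => hB _)
  simp only [intervalIntegral.integral_of_le zero_le_one]
  rw [integral_integral_swap hint]
  have h1 : ∀ s : ℝ, ∫ x, f (φ s x) ∂(μ : Measure X) = ∫ x, f x ∂(μ : Measure X) := fun s => by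
    have := integral_map (μ := (μ : Measure X)) (hμ s).measurable.aemeasurable (f := f)
      hf.continuous.measurable.aestronglyMeasurable
    rw [(hμ s).map_eq] at this
    exact this.symm
  simp [h1]

/-- If the closing lemma holds and a bounded Lipschitz function has nonnegative integrals along all
periodic orbits, then it has a nonnegative integral for all invariant measures. -/
theorem integral_nonneg_of_periodic {φ : Flow ℝ X} (hclosing : SatisfiesClosingLemma φ) {f : X → ℝ}
    (hf : BoundedLipschitz f)
    (hper : ∀ (x : X) (l : ℝ), 0 < l → φ l x = x → 0 ≤ ∫ s in (0 : ℝ)..l, f (φ s x))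
    {μ : ProbabilityMeasure X} (hμ : μ ∈ invariantMeasures φ) : 0 ≤ ∫ x, f x ∂(μ : Measure X) := by
  obtain ⟨B, L, hB0, hL0, hB, hL⟩ := id hf
  suffices h : ∀ ε : ℝ, 0 < ε → 0 ≤ ∫ x, f x ∂(μ : Measure X) + (L + B) * ε by
    by_contra! hneg
    obtain ⟨ε, hε, hε'⟩ : ∃ ε : ℝ, 0 < ε ∧ (L + B) * ε < -∫ x, f x ∂(μ : Measure X) := by
      refine ⟨-(∫ x, f x ∂(μ : Measure X)) / (L + B + 1), by
        apply div_pos <;> linarith, ?_⟩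
      rw [mul_div_assoc', div_lt_iff₀ (by positivity)]
      nlinarith
    linarith [h ε hε]
  intro ε hε
  have hcont : Continuous fun p : X × ℝ => f (φ p.2 p.1) :=
    hf.continuous.comp (φ.continuous continuous_snd continuous_fst)
  have hcF : Continuous fun x => ∫ s in (0 : ℝ)..1, f (φ s x) :=
    intervalIntegral.continuous_parametric_intervalIntegral_of_continuous' hcont 0 1
  have hbF : ∀ x, |∫ s in (0 : ℝ)..1, f (φ s x)| ≤ B := fun x => by
    simpa using intervalIntegral.norm_integral_le_of_norm_le_const (a := (0 : ℝ)) (b := 1) (C := B)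
      (f := fun s => f (φ s x)) fun s _ => hB _
  -- The slack `(L + B) * ε` per unit time pays for the error made in closing an orbit segment.
  let h : X → ℝ := fun x => (∫ s in (0 : ℝ)..1, f (φ s x)) + (L + B) * ε
  have hintF : Integrable (fun x => ∫ s in (0 : ℝ)..1, f (φ s x)) (μ : Measure X) :=
    Integrable.of_bound hcF.aestronglyMeasurable B (Eventually.of_forall hbF)
  have hh : ∫ x, h x ∂(μ : Measure X) = ∫ x, f x ∂(μ : Measure X) + (L + B) * ε := by
    simp only [h]
    rw [integral_add hintF (integrable_const _), integral_integral_orbit hf hμ]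
    simp
  rw [← hh]
  have hbirk : ∀ (n : ℕ) (x : X), birkhoffSum (φ 1) h n x =
      (∫ s in (0 : ℝ)..n, f (φ s x)) + n * ((L + B) * ε) := by
    intro n x
    have hadj := intervalIntegral.sum_integral_adjacent_intervals (n := n) (a := fun k : ℕ => (k : ℝ))
      (f := fun s => f (φ s x)) (μ := volume) fun k _ =>
        (hf.continuous.comp (continuous_orbit φ x)).intervalIntegrable _ _
    simp only [Nat.cast_zero] at hadj
    rw [← hadj]
    simp only [birkhoffSum, h, Finset.sum_add_distrib, Finset.sum_const, Finset.card_range,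
      nsmul_eq_mul]
    congr 1
    refine Finset.sum_congr rfl fun k _ => ?_
    simp only [iterate_flow_one, ← φ.map_add]
    rw [intervalIntegral.integral_comp_add_right (fun s => f (φ s x)) (k : ℝ)]
    push_cast
    rw [zero_add, add_comm 1 (k : ℝ)]
  refine integral_nonneg_of_birkhoffSum_nonneg (K := B + (L + B) * ε) (hμ 1)
    (hcF.add continuous_const).measurable (fun x => ?_) ?_
  · have : 0 ≤ (L + B) * ε := by positivity
    exact (abs_add_le _ _).trans (add_le_add (hbF x) (abs_of_nonneg this).le)
  choose V hV hVc using hclosing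
  choose δ hδ t₀ ht₀ hVc using fun v => hVc v ε hε
  let W : X → Set X := fun v => interior (V v) ∩ Metric.ball v (δ v / 2)
  have hWo : ∀ v, IsOpen (W v) := fun v => isOpen_interior.inter Metric.isOpen_ball
  have hW : ∀ v, W v ∈ 𝓝 v := fun v =>
    inter_mem (interior_mem_nhds.2 (hV v)) (Metric.ball_mem_nhds v (half_pos (hδ v)))
  obtain ⟨S, hS, hSW⟩ := TopologicalSpace.countable_cover_nhds hW
  -- Poincaré recurrence for a countable cover: two visits to `W v` are within `δ v`, so the closing
  -- lemma applies to every long return.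
  have hrec : ∀ᵐ x ∂(μ : Measure X), ∀ v ∈ S, x ∈ W v → ∃ᶠ n in atTop, (φ 1)^[n] x ∈ W v :=
    (ae_ball_iff hS).2 fun v _ =>
      (hμ 1).conservative.ae_mem_imp_frequently_image_mem (hWo v).measurableSet.nullMeasurableSet
  filter_upwards [hrec] with x hx
  obtain ⟨v, hvS, hxv⟩ := mem_iUnion₂.1 (hSW.symm ▸ mem_univ x : x ∈ ⋃ v ∈ S, W v)
  obtain ⟨N, hN⟩ := exists_nat_gt (t₀ v)
  obtain ⟨n, hn, hnW⟩ := frequently_atTop.1 (hx v hvS hxv) (N + 1)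
  obtain ⟨k, rfl⟩ : ∃ k, n = k + 1 := ⟨n - 1, by omega⟩
  rw [iterate_flow_one] at hnW
  have hn0 : t₀ v < ((k + 1 : ℕ) : ℝ) := hN.trans_le (by exact_mod_cast (by omega : N ≤ k + 1))
  obtain ⟨x₀, l, hl, hlt, hx₀, hclose⟩ := hVc v x (interior_subset hxv.1) _ hn0 (by
    have h1 := Metric.mem_ball.1 hxv.2
    have h2 := Metric.mem_ball.1 hnW.2
    linarith [dist_triangle_right x (φ ((k + 1 : ℕ) : ℝ) x) v]) (interior_subset hnW.1)
  have hkpos : (0 : ℝ) < ((k + 1 : ℕ) : ℝ) := (ht₀ v).trans hn0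
  have hk1 : (1 : ℝ) ≤ ((k + 1 : ℕ) : ℝ) := by exact_mod_cast (by omega : 1 ≤ k + 1)
  have hcomp := abs_integral_orbit_sub_le hf.continuous hB hL0 hL hl hkpos hlt hclose
  have hp := hper x₀ l hl hx₀
  refine ⟨k, ?_⟩
  rw [hbirk]
  have := (abs_le.1 hcomp).2
  have hBε : B * ε ≤ ((k + 1 : ℕ) : ℝ) * (B * ε) := le_mul_of_one_le_left (by positivity) hk1
  nlinarith

end Closing


/-! ### Gluing two periodic orbits -/

section Gluing

variable {X : Type*} [MetricSpace X] {φ : Flow ℝ X}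

/-- The local product structure, spelled out in terms of distances between orbits. -/
theorem HasLocalProductStructure.exists_glue (hprod : HasLocalProductStructure φ) (v : X) {ε : ℝ}
    (hε : 0 < ε) : ∃ ρ : ℝ, 0 < ρ ∧ ∀ x y : X, dist x v < ρ → dist y v < ρ →
      ∃ (z : X) (τ : ℝ), |τ| ≤ ε ∧ (∀ s : ℝ, 0 ≤ s → dist (φ s y) (φ s z) ≤ ε) ∧
        ∀ s : ℝ, s ≤ 0 → dist (φ (s + τ) x) (φ s z) ≤ ε := by
  obtain ⟨V, hV, hVε⟩ := hprod v
  obtain ⟨δ, hδ, h⟩ := hVε ε hε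
  obtain ⟨r, hr, hrV⟩ := Metric.mem_nhds_iff.1 hV
  refine ⟨min r (δ / 2), lt_min hr (half_pos hδ), fun x y hx hy => ?_⟩
  obtain ⟨z, τ, hτ, hzu, hzs⟩ := h x (hrV (hx.trans_le (min_le_left _ _))) y
    (hrV (hy.trans_le (min_le_left _ _))) (by
      have h1 := hx.trans_le (min_le_right r (δ / 2))
      have h2 := hy.trans_le (min_le_right r (δ / 2))
      linarith [dist_triangle_right x y v])
  refine ⟨z, τ, hτ, hzs.2, fun s hs => ?_⟩
  have h1 := hzu.2 (-s) (by linarith)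
  simpa only [Flow.reverse_apply, neg_neg, ← φ.map_add] using h1

/-- In a transitive flow with local product structure, there is an orbit that follows a first
periodic orbit for a long time, then a second one for a long time, and then comes back close to its
origin; the transition times do not depend on the lengths of the two periods of shadowing. -/
theorem exists_orbit_shadowing_two_periodic (htrans : IsTransitive φ)
    (hprod : HasLocalProductStructure φ) (p q : X) {ε : ℝ} (hε : 0 < ε) :
    ∃ T₁ T₂ : ℝ, 0 ≤ T₁ ∧ 0 ≤ T₂ ∧ ∀ A M : ℝ, 2 * ε ≤ A → 0 ≤ M → φ A p = p → φ M q = q →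
      ∃ (x : X) (τ σ : ℝ), |τ| ≤ 3 * ε ∧ |σ| ≤ ε ∧
        (∀ u : ℝ, u ≤ A - 2 * ε → dist (φ u x) (φ (τ + u) p) ≤ 3 * ε) ∧
        (∀ u : ℝ, ε ≤ u → u ≤ M → dist (φ (A + T₁ + u) x) (φ (σ + u) q) ≤ 3 * ε) ∧
        dist (φ (A + T₁ + M + T₂) x) p ≤ 2 * ε := by
  -- Tolerances are chosen backwards: each gluing must be precise enough to enter the domain of the
  -- next.
  obtain ⟨ρC, hρC, hC⟩ := hprod.exists_glue q hε
  have hεB : 0 < min ε (ρC / 2) := lt_min hε (half_pos hρC)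
  obtain ⟨ρB, hρB, hB⟩ := hprod.exists_glue q hεB
  have hεA : 0 < min ε (ρB / 2) := lt_min hε (half_pos hρB)
  obtain ⟨ρA, hρA, hA⟩ := hprod.exists_glue p hεA
  -- The connecting segments, from `p` to `q` and back, are fixed before `A` and `M`, so `T₁` and
  -- `T₂` do not depend on them.
  obtain ⟨T₁, hT₁, _, ⟨w₀, hw₀, rfl⟩, hw₀'⟩ := htrans (Metric.ball p ρA) (Metric.ball q (ρB / 2))
    Metric.isOpen_ball ⟨p, Metric.mem_ball_self hρA⟩ Metric.isOpen_ball
    ⟨q, Metric.mem_ball_self (half_pos hρB)⟩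
  obtain ⟨T₂, hT₂, _, ⟨w₁, hw₁, rfl⟩, hw₁'⟩ := htrans (Metric.ball q ρC) (Metric.ball p ε)
    Metric.isOpen_ball ⟨q, Metric.mem_ball_self hρC⟩ Metric.isOpen_ball
    ⟨p, Metric.mem_ball_self hε⟩
  refine ⟨T₁, T₂, hT₁, hT₂, fun A M hAε hM hp hq => ?_⟩
  -- Three gluings: `z₁` has the past of `p` and the future of `w₀`; `z₂` the past of `φ T₁ z₁` and
  -- the future of `q`; `z₃` the past of `φ M z₂` and the future of `w₁`.
  obtain ⟨z₁, τ₁, hτ₁, hs₁, hu₁⟩ := hA p w₀ (by simpa using hρA) hw₀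
  obtain ⟨z₂, τ₂, hτ₂, hs₂, hu₂⟩ := hB (φ T₁ z₁) q (by
    have h1 := (hs₁ T₁ hT₁).trans (min_le_right _ _)
    have h2 := Metric.mem_ball.1 hw₀'
    rw [dist_comm] at h1
    linarith [dist_triangle (φ T₁ z₁) (φ T₁ w₀) q]) (by simpa using hρB)
  obtain ⟨z₃, τ₃, hτ₃, hs₃, hu₃⟩ := hC (φ M z₂) w₁ (by
    have h1 := (hs₂ M hM).trans (min_le_right _ _)
    rw [hq, dist_comm] at h1
    linarith) hw₁
  replace hτ₁ := abs_le.1 (hτ₁.trans (min_le_left _ _))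
  replace hτ₂ := abs_le.1 (hτ₂.trans (min_le_left _ _))
  replace hu₁ := fun s hs => (hu₁ s hs).trans (min_le_left _ _)
  replace hs₂ := fun s hs => (hs₂ s hs).trans (min_le_left _ _)
  replace hu₂ := fun s hs => (hu₂ s hs).trans (min_le_left _ _)
  have hτ₃' := abs_le.1 hτ₃
  have hpA : ∀ s : ℝ, φ (s - A) p = φ s p := fun s => by
    have := periodic_orbit hp (s - A)
    simpa using this.symm
  have h3 : ∀ u : ℝ, u ≤ A + T₁ + M →
      dist (φ u (φ (-(A + T₁ + M)) z₃)) (φ (u - A - T₁ + τ₃) z₂) ≤ ε := by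
    intro u hu
    have h := hu₃ (u - (A + T₁ + M)) (by linarith)
    rw [← φ.map_add, dist_comm] at h
    rw [← φ.map_add]
    convert h using 3 <;> ring
  -- The time shifts accumulate backwards. The cutoffs `u ≤ A - 2 * ε` and `ε ≤ u` keep the shifted
  -- times on the half-line where each estimate holds.
  refine ⟨φ (-(A + T₁ + M)) z₃, τ₁ + τ₂ + τ₃, τ₃, abs_le.2 ⟨by linarith, by linarith⟩, hτ₃,
    fun u hu => ?_, fun u hu hu' => ?_, ?_⟩
  · have h1 := h3 u (by linarith)
    have h2 := hu₂ (u - A - T₁ + τ₃) (by linarith)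
    rw [← φ.map_add, show u - A - T₁ + τ₃ + τ₂ + T₁ = u - A + τ₃ + τ₂ by ring] at h2
    have h4 := hu₁ (u - A + τ₃ + τ₂) (by linarith)
    rw [show u - A + τ₃ + τ₂ + τ₁ = τ₁ + τ₂ + τ₃ + u - A by ring, hpA] at h4
    rw [dist_comm] at h2 h4
    linarith [dist_triangle4 (φ u (φ (-(A + T₁ + M)) z₃)) (φ (u - A - T₁ + τ₃) z₂)
      (φ (u - A + τ₃ + τ₂) z₁) (φ (τ₁ + τ₂ + τ₃ + u) p)]
  · have h1 := h3 (A + T₁ + u) (by linarith)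
    rw [show A + T₁ + u - A - T₁ + τ₃ = τ₃ + u by ring] at h1
    have h2 := hs₂ (τ₃ + u) (by linarith)
    rw [dist_comm] at h2
    linarith [dist_triangle (φ (A + T₁ + u) (φ (-(A + T₁ + M)) z₃)) (φ (τ₃ + u) z₂) (φ (τ₃ + u) q)]
  · have h1 := hs₃ T₂ hT₂
    have h2 := Metric.mem_ball.1 hw₁'
    rw [← φ.map_add, show A + T₁ + M + T₂ + -(A + T₁ + M) = T₂ by ring]
    rw [dist_comm] at h1
    linarith [dist_triangle (φ T₂ z₃) (φ T₂ w₁) p]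

/-- Comparison of the integrals of two bounded functions that are close on a subinterval. -/
theorem abs_intervalIntegral_sub_le_of_close {F G : ℝ → ℝ} (hF : Continuous F) (hG : Continuous G)
    {B η a b c d : ℝ} (hFB : ∀ u, |F u| ≤ B) (hGB : ∀ u, |G u| ≤ B) (hca : c ≤ a) (hab : a ≤ b)
    (hbd : b ≤ d) (h : ∀ u, a ≤ u → u ≤ b → |F u - G u| ≤ η) :
    |(∫ u in c..d, F u) - ∫ u in c..d, G u| ≤ η * (b - a) + 2 * B * ((a - c) + (d - b)) := by
  have hi : ∀ x y : ℝ, IntervalIntegrable (fun u => F u - G u) volume x y := fun x y =>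
    (hF.sub hG).intervalIntegrable x y
  have hFG : ∀ u, ‖F u - G u‖ ≤ 2 * B := fun u => by
    have := abs_sub (F u) (G u)
    rw [Real.norm_eq_abs]
    linarith [hFB u, hGB u]
  rw [← intervalIntegral.integral_sub (hF.intervalIntegrable c d) (hG.intervalIntegrable c d),
    ← intervalIntegral.integral_add_adjacent_intervals (hi c a) (hi a d),
    ← intervalIntegral.integral_add_adjacent_intervals (hi a b) (hi b d)]
  have h1 : ‖∫ u in c..a, (F u - G u)‖ ≤ 2 * B * |a - c| :=
    intervalIntegral.norm_integral_le_of_norm_le_const fun u _ => hFG u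
  have h2 : ‖∫ u in a..b, (F u - G u)‖ ≤ η * |b - a| :=
    intervalIntegral.norm_integral_le_of_norm_le_const fun u hu => by
      rw [uIoc_of_le hab] at hu
      exact h u hu.1.le hu.2
  have h3 : ‖∫ u in b..d, (F u - G u)‖ ≤ 2 * B * |d - b| :=
    intervalIntegral.norm_integral_le_of_norm_le_const fun u _ => hFG u
  rw [abs_of_nonneg (by linarith)] at h1 h2 h3
  rw [Real.norm_eq_abs] at h1 h2 h3
  rw [abs_le] at *
  constructor <;> linarith

/-- The integral along an orbit that shadows two periodic orbits one after the other. -/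
theorem abs_integral_shadowing_sub_le {f : X → ℝ} {B L ε A M T₁ T₂ τ σ : ℝ} {x p q : X}
    (hfc : Continuous f) (hB : ∀ x, |f x| ≤ B) (hL0 : 0 ≤ L)
    (hL : ∀ x y, |f x - f y| ≤ L * dist x y) (hε : 0 < ε) (hA : 2 * ε ≤ A) (hM : ε ≤ M)
    (hT₁ : 0 ≤ T₁) (hT₂ : 0 ≤ T₂) (hp : φ A p = p) (hq : φ M q = q)
    (hxp : ∀ u : ℝ, u ≤ A - 2 * ε → dist (φ u x) (φ (τ + u) p) ≤ 3 * ε)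
    (hxq : ∀ u : ℝ, ε ≤ u → u ≤ M → dist (φ (A + T₁ + u) x) (φ (σ + u) q) ≤ 3 * ε) :
    |(∫ u in (0 : ℝ)..(A + T₁ + M + T₂), f (φ u x)) -
      ((∫ u in (0 : ℝ)..A, f (φ u p)) + ∫ u in (0 : ℝ)..M, f (φ u q))| ≤
      3 * ε * L * (A + M) + B * (T₁ + T₂ + 6 * ε) := by
  have hB0 : 0 ≤ B := (abs_nonneg _).trans (hB x)
  have hcont : ∀ (c : ℝ) (y : X), Continuous fun u => f (φ (c + u) y) := fun c y =>
    hfc.comp ((continuous_orbit φ y).comp (continuous_const.add continuous_id))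
  have hi : ∀ a b : ℝ, IntervalIntegrable (fun u => f (φ u x)) volume a b := fun a b =>
    (hfc.comp (continuous_orbit φ x)).intervalIntegrable a b
  have h1 := abs_intervalIntegral_sub_le_of_close (η := L * (3 * ε)) (a := 0) (b := A - 2 * ε)
    (c := 0) (d := A) (hfc.comp (continuous_orbit φ x)) (hcont τ p) (fun u => hB _) (fun u => hB _)
    le_rfl (by linarith) (by linarith) fun u _ hu =>
      (hL _ _).trans (mul_le_mul_of_nonneg_left (hxp u hu) hL0)
  have h2 := abs_intervalIntegral_sub_le_of_close (η := L * (3 * ε)) (a := ε) (b := M)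
    (c := 0) (d := M) (hcont (A + T₁) x) (hcont σ q) (fun u => hB _) (fun u => hB _)
    hε.le hM le_rfl fun u hu hu' =>
      (hL _ _).trans (mul_le_mul_of_nonneg_left (hxq u hu hu') hL0)
  -- Over a whole period the phase shifts `σ` and `τ` do not affect the integral. The uncontrolled
  -- windows, of total length `3 * ε`, account for the term `6 * ε`.
  rw [integral_flow_add_periodic hq f,
    intervalIntegral.integral_comp_add_left (fun u => f (φ u x)), add_zero] at h2
  rw [integral_flow_add_periodic hp f] at h1
  have h3 : ‖∫ u in A..(A + T₁), f (φ u x)‖ ≤ B * |A + T₁ - A| :=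
    intervalIntegral.norm_integral_le_of_norm_le_const fun u _ => hB _
  have h4 : ‖∫ u in (A + T₁ + M)..(A + T₁ + M + T₂), f (φ u x)‖ ≤ B * |A + T₁ + M + T₂ - (A + T₁ + M)| :=
    intervalIntegral.norm_integral_le_of_norm_le_const fun u _ => hB _
  rw [add_sub_cancel_left, abs_of_nonneg hT₁, Real.norm_eq_abs] at h3
  rw [add_sub_cancel_left, abs_of_nonneg hT₂, Real.norm_eq_abs] at h4
  rw [← intervalIntegral.integral_add_adjacent_intervals (hi 0 A) (hi A (A + T₁ + M + T₂)),
    ← intervalIntegral.integral_add_adjacent_intervals (hi A (A + T₁)) (hi (A + T₁) (A + T₁ + M + T₂)),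
    ← intervalIntegral.integral_add_adjacent_intervals (hi (A + T₁) (A + T₁ + M))
      (hi (A + T₁ + M) (A + T₁ + M + T₂))]
  have h5 : 0 ≤ L * ε * ε := by positivity
  simp only [Function.comp_def] at h1
  rw [abs_le] at *
  constructor <;> linarith

/-- Gluing of two periodic orbits: up to a bounded error and a small error proportional to the
length, there is a periodic orbit that realizes any pair of multiples of their periods. -/
theorem exists_periodic_gluing (htrans : IsTransitive φ) (hprod : HasLocalProductStructure φ)
    (hclosing : SatisfiesClosingLemma φ) (p q : X) {η : ℝ} (hη : 0 < η) :
    ∃ C A₀ : ℝ, 0 ≤ C ∧ ∀ A M : ℝ, A₀ ≤ A → A₀ ≤ M → φ A p = p → φ M q = q →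
      ∃ (r : X) (l : ℝ), 0 < l ∧ φ l r = r ∧ |l - (A + M)| ≤ C ∧
        ∀ (f : X → ℝ) (B L : ℝ), (∀ x, |f x| ≤ B) → 0 ≤ L →
          (∀ x y, |f x - f y| ≤ L * dist x y) → Continuous f →
          |(∫ u in (0 : ℝ)..l, f (φ u r)) -
            ((∫ u in (0 : ℝ)..A, f (φ u p)) + ∫ u in (0 : ℝ)..M, f (φ u q))| ≤
            η * L * (A + M) + C * (B + L) := by
  obtain ⟨V, hV, hVη⟩ := hclosing p
  obtain ⟨δ, hδ, t₀, ht₀, hclose⟩ := hVη (η / 4) (by positivity)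
  obtain ⟨r₀, hr₀, hr₀V⟩ := Metric.mem_nhds_iff.1 hV
  obtain ⟨ρ, hρ, hρ1, hρ2⟩ : ∃ ρ : ℝ, 0 < ρ ∧ ρ ≤ r₀ ∧ ρ ≤ δ / 2 :=
    ⟨min r₀ (δ / 2), lt_min hr₀ (half_pos hδ), min_le_left _ _, min_le_right _ _⟩
  -- The shadowing orbit starts near `φ τ p` rather than `p`, with `|τ| ≤ 3 * ε`; taking `3 * ε < κ`
  -- keeps it near `p`.
  obtain ⟨κ, hκ, hκp⟩ := Metric.continuousAt_iff.1
    ((continuous_orbit φ p).continuousAt (x := (0 : ℝ))) (ρ / 2) (half_pos hρ)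
  simp only [φ.map_zero_apply] at hκp
  obtain ⟨ε, hε, hε1, hε2, hε3⟩ : ∃ ε : ℝ, 0 < ε ∧ 3 * ε < κ ∧ 3 * ε < ρ / 2 ∧ ε ≤ η / 4 := by
    refine ⟨min (κ / 4) (min (ρ / 8) (η / 4)), by positivity, ?_, ?_, ?_⟩
    · linarith [min_le_left (κ / 4) (min (ρ / 8) (η / 4))]
    · linarith [min_le_right (κ / 4) (min (ρ / 8) (η / 4)), min_le_left (ρ / 8) (η / 4)]
    · linarith [min_le_right (κ / 4) (min (ρ / 8) (η / 4)), min_le_right (ρ / 8) (η / 4)]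
  obtain ⟨T₁, T₂, hT₁, hT₂, hshadow⟩ := exists_orbit_shadowing_two_periodic htrans hprod p q hε
  -- `C` collects the transition and closing errors, all independent of `A` and `M`; `t₀ + 1` makes
  -- the return time exceed `t₀`.
  refine ⟨(T₁ + T₂) * (1 + η) + 2 * η, max (2 * ε) (t₀ + 1), by positivity,
    fun A M hA hM hp hq => ?_⟩
  have hA1 : 2 * ε ≤ A := (le_max_left _ _).trans hA
  have hM1 : 2 * ε ≤ M := (le_max_left _ _).trans hM
  have hA2 : t₀ + 1 ≤ A := (le_max_right _ _).trans hA
  obtain ⟨x, τ, σ, hτ, -, hxp, hxq, hend⟩ := hshadow A M hA1 (by linarith) hp hq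
  have hstart : dist x p < ρ := by
    have h1 := hxp 0 (by linarith)
    rw [φ.map_zero_apply, add_zero] at h1
    have h2 := hκp (x := τ) (by rw [Real.dist_eq, sub_zero]; linarith)
    linarith [dist_triangle x (φ τ p) p]
  have hend' : dist (φ (A + T₁ + M + T₂) x) p < ρ := by linarith
  obtain ⟨r, l, hl, hlt, hr, hcl⟩ := hclose x (hr₀V (hstart.trans_le hρ1)) (A + T₁ + M + T₂)
    (by linarith) (by linarith [dist_triangle_right x (φ (A + T₁ + M + T₂) x) p])
    (hr₀V (hend'.trans_le hρ1))
  have hTη : 0 ≤ (T₁ + T₂) * η := by positivity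
  refine ⟨r, l, hl, hr, ?_, fun f B L hB hL0 hL hfc => ?_⟩
  · rw [abs_lt] at hlt
    rw [abs_le]
    constructor <;> nlinarith
  · have hB0 : 0 ≤ B := (abs_nonneg _).trans (hB x)
    have h1 := abs_integral_orbit_sub_le hfc hB hL0 hL hl (by linarith) hlt hcl
    have h2 := abs_integral_shadowing_sub_le hfc hB hL0 hL hε hA1 (by linarith) hT₁ hT₂ hp hq
      hxp hxq
    have h3 : L * (η / 4) * (A + T₁ + M + T₂) + B * (η / 4) +
        (3 * ε * L * (A + M) + B * (T₁ + T₂ + 6 * ε)) ≤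
        η * L * (A + M) + ((T₁ + T₂) * (1 + η) + 2 * η) * (B + L) := by
      have e1 : 3 * ε * L * (A + M) ≤ 3 * (η / 4) * L * (A + M) := by
        have : 0 ≤ L * (A + M) := mul_nonneg hL0 (by linarith)
        nlinarith
      have e2 : B * (T₁ + T₂ + 6 * ε) ≤ B * (T₁ + T₂ + 6 * (η / 4)) := by
        have := mul_le_mul_of_nonneg_left hε3 hB0
        nlinarith
      have e3 : 0 ≤ (T₁ + T₂) * η * B := by positivity
      have e4 : 0 ≤ (T₁ + T₂) * η * L := by positivity
      have e5 : 0 ≤ (T₁ + T₂) * L := by positivity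
      have e6 : 0 ≤ η * B := by positivity
      have e7 : 0 ≤ η * L := by positivity
      nlinarith
    calc _ ≤ _ := abs_sub_le _ (∫ u in (0 : ℝ)..(A + T₁ + M + T₂), f (φ u x)) _
      _ ≤ _ := add_le_add h1 h2
      _ ≤ _ := h3

end Gluing


/-! ### Density of periodic measures and of measures charging an open set -/

section Density

/-- A periodic orbit has periods near any time, along which the integral of a function
is the period times its average. -/
theorem exists_period_near {X : Type*} [TopologicalSpace X] {φ : Flow ℝ X} {p : X} {a : ℝ}
    (ha : 0 < a) (hp : φ a p = p) (T : ℝ) :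
    ∃ A : ℝ, A ≤ T ∧ T - a ≤ A ∧ φ A p = p ∧ ∀ f : X → ℝ, Continuous f →
      ∫ u in (0 : ℝ)..A, f (φ u p) = A * (a⁻¹ * ∫ u in (0 : ℝ)..a, f (φ u p)) := by
  have hA : (⌊T / a⌋ : ℝ) * a ≤ T := (le_div_iff₀ ha).1 (Int.floor_le _)
  refine ⟨⌊T / a⌋ * a, hA, ?_, ?_, fun f hf => ?_⟩
  · have := (div_lt_iff₀ ha).1 (Int.lt_floor_add_one (T / a))
    linarith
  · have := (periodic_orbit hp).int_mul ⌊T / a⌋ 0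
    simpa using this
  · have hper : Function.Periodic (fun u : ℝ => f (φ u p)) a := (periodic_orbit hp).comp f
    have h := hper.intervalIntegral_add_zsmul_eq ⌊T / a⌋ 0 fun _ _ =>
      (hf.comp (continuous_orbit φ p)).intervalIntegrable _ _
    simp only [zero_add, zsmul_eq_mul] at h
    rw [h]
    field_simp

theorem abs_average_le {X : Type*} {φ : ℝ → X → X} {f : X → ℝ} {B : ℝ} (hB : ∀ x, |f x| ≤ B) (x : X)
    {l : ℝ} (hl : 0 < l) : |l⁻¹ * ∫ u in (0 : ℝ)..l, f (φ u x)| ≤ B := by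
  have h : ‖∫ u in (0 : ℝ)..l, f (φ u x)‖ ≤ B * |l - 0| :=
    intervalIntegral.norm_integral_le_of_norm_le_const fun u _ => hB _
  rw [sub_zero, abs_of_pos hl, Real.norm_eq_abs] at h
  rw [abs_mul, abs_of_pos (inv_pos.2 hl), inv_mul_le_iff₀ hl]
  linarith

variable {X : Type*} [MetricSpace X] {φ : Flow ℝ X}

/-- Finitely many bounded Lipschitz functions have common bounds. -/
theorem exists_common_bounds (I : Finset {f : X → ℝ // BoundedLipschitz f}) :
    ∃ B L : ℝ, 0 ≤ B ∧ 0 ≤ L ∧ ∀ f ∈ I, (∀ x, |f.1 x| ≤ B) ∧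
      ∀ x y, |f.1 x - f.1 y| ≤ L * dist x y := by
  choose B L hB0 hL0 hB hL using fun f : {f : X → ℝ // BoundedLipschitz f} => f.2
  refine ⟨∑ f ∈ I, B f, ∑ f ∈ I, L f, Finset.sum_nonneg fun f _ => hB0 f,
    Finset.sum_nonneg fun f _ => hL0 f, fun f hf => ⟨fun x => (hB f x).trans ?_,
    fun x y => (hL f x y).trans ?_⟩⟩
  · exact Finset.single_le_sum (fun f _ => hB0 f) hf
  · exact mul_le_mul_of_nonneg_right (Finset.single_le_sum (fun f _ => hL0 f) hf) dist_nonneg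

/-- Convex combinations of averages along two periodic orbits are approximated by averages along
one periodic orbit. -/
theorem exists_periodic_average_near (htrans : IsTransitive φ) (hprod : HasLocalProductStructure φ)
    (hclosing : SatisfiesClosingLemma φ) {p q : X} {a b : ℝ} (ha : 0 < a) (hb : 0 < b)
    (hp : φ a p = p) (hq : φ b q = q) {c d : ℝ} (hc : 0 < c) (hd : 0 < d) (hcd : c + d = 1)
    (I : Finset {f : X → ℝ // BoundedLipschitz f}) {κ : ℝ} (hκ : 0 < κ) :
    ∃ (r : X) (l : ℝ), 0 < l ∧ φ l r = r ∧ ∀ f ∈ I,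
      |l⁻¹ * (∫ u in (0 : ℝ)..l, f.1 (φ u r)) - (c * (a⁻¹ * ∫ u in (0 : ℝ)..a, f.1 (φ u p)) +
        d * (b⁻¹ * ∫ u in (0 : ℝ)..b, f.1 (φ u q)))| < κ := by
  obtain ⟨B, L, hB0, hL0, hBL⟩ := exists_common_bounds I
  obtain ⟨η, hη, hηL⟩ : ∃ η : ℝ, 0 < η ∧ η * L < κ / 2 := by
    refine ⟨κ / 2 / (L + 1), by positivity, ?_⟩
    rw [div_mul_eq_mul_div, div_lt_iff₀ (by positivity)]
    nlinarith
  obtain ⟨C, A₀, hC, hglue⟩ := exists_periodic_gluing htrans hprod hclosing p q hη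
  -- The bounded errors: gluing, rounding `c * K` and `d * K` to multiples of the periods, and
  -- replacing the length `l` by `K`. Division by a large `K` makes them negligible.
  set C' : ℝ := C * (B + L) + (a + b) * B + (C + a + b) * B with hC'
  have hC'0 : 0 ≤ C' := by positivity
  obtain ⟨K, hK0, hKc, hKd, hKC⟩ : ∃ K : ℝ, 0 < K ∧ A₀ ≤ c * K - a ∧ A₀ ≤ d * K - b ∧
      C' < κ / 2 * K := by
    have h1 : Tendsto (fun K : ℝ => c * K) atTop atTop := tendsto_id.const_mul_atTop hc
    have h2 : Tendsto (fun K : ℝ => d * K) atTop atTop := tendsto_id.const_mul_atTop hd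
    have h3 : Tendsto (fun K : ℝ => κ / 2 * K) atTop atTop := tendsto_id.const_mul_atTop (half_pos hκ)
    obtain ⟨K, h⟩ := ((eventually_gt_atTop 0).and ((h1.eventually_ge_atTop (A₀ + a)).and
      ((h2.eventually_ge_atTop (A₀ + b)).and (h3.eventually_gt_atTop C')))).exists
    exact ⟨K, h.1, by linarith [h.2.1], by linarith [h.2.2.1], h.2.2.2⟩
  obtain ⟨A, hA1, hA2, hAp, hAf⟩ := exists_period_near ha hp (c * K)
  obtain ⟨M, hM1, hM2, hMq, hMf⟩ := exists_period_near hb hq (d * K)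
  obtain ⟨r, l, hl, hr, hlC, hrf⟩ := hglue A M (hKc.trans hA2) (hKd.trans hM2) hAp hMq
  refine ⟨r, l, hl, hr, fun f hf => ?_⟩
  have hfc := f.2.continuous
  obtain ⟨hB, hL⟩ := hBL f hf
  have h1 := hrf f.1 B L hB hL0 hL hfc
  rw [hAf f.1 hfc, hMf f.1 hfc] at h1
  have hP := abs_average_le (φ := φ) hB p ha
  have hQ := abs_average_le (φ := φ) hB q hb
  have hR := abs_average_le (φ := φ) hB r hl
  have hint : ∫ u in (0 : ℝ)..l, f.1 (φ u r) = l * (l⁻¹ * ∫ u in (0 : ℝ)..l, f.1 (φ u r)) := by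
    rw [mul_inv_cancel_left₀ hl.ne']
  rw [hint] at h1
  set P := a⁻¹ * ∫ u in (0 : ℝ)..a, f.1 (φ u p)
  set Q := b⁻¹ * ∫ u in (0 : ℝ)..b, f.1 (φ u q)
  set R := l⁻¹ * ∫ u in (0 : ℝ)..l, f.1 (φ u r)
  have hK : K = c * K + d * K := by rw [← add_mul, hcd, one_mul]
  have h2 : |(A - c * K) * P| ≤ a * B := by
    rw [abs_mul]
    exact mul_le_mul (abs_le.2 ⟨by linarith, by linarith⟩) hP (abs_nonneg _) ha.le
  have h3 : |(M - d * K) * Q| ≤ b * B := by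
    rw [abs_mul]
    exact mul_le_mul (abs_le.2 ⟨by linarith, by linarith⟩) hQ (abs_nonneg _) hb.le
  have h4 : |(l - K) * R| ≤ (C + a + b) * B := by
    rw [abs_mul]
    refine mul_le_mul ?_ hR (abs_nonneg _) (by positivity)
    rw [abs_le] at hlC ⊢
    constructor <;> linarith
  have h5 : η * L * (A + M) ≤ κ / 2 * K := by
    have e1 : η * L * (A + M) ≤ η * L * K := by
      refine mul_le_mul_of_nonneg_left ?_ (by positivity)
      linarith
    have e2 : η * L * K ≤ κ / 2 * K := mul_le_mul_of_nonneg_right hηL.le hK0.le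
    exact e1.trans e2
  have h6 : K * |R - (c * P + d * Q)| < K * κ := by
    rw [← abs_of_pos hK0, ← abs_mul, abs_of_pos hK0]
    have e : K * (R - (c * P + d * Q)) =
        (l * R - (A * P + M * Q)) + (A - c * K) * P + (M - d * K) * Q - (l - K) * R := by ring
    rw [e]
    rw [abs_le] at h1 h2 h3 h4
    rw [abs_lt]
    constructor <;> linarith
  exact lt_of_mul_lt_mul_left h6 hK0.le

/-- The vectors of averages of finitely many functions along periodic orbits. -/
def periodicAverages (φ : Flow ℝ X) (I : Finset {f : X → ℝ // BoundedLipschitz f}) :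
    Set (I → ℝ) :=
  {v | ∃ (x : X) (l : ℝ), 0 < l ∧ φ l x = x ∧
    v = fun f => l⁻¹ * ∫ u in (0 : ℝ)..l, f.1.1 (φ u x)}

/-- By continuity of convex combinations, it is enough to approximate those of two actual periodic
averages, as `exists_periodic_average_near` does. -/
theorem convex_closure_periodicAverages (htrans : IsTransitive φ)
    (hprod : HasLocalProductStructure φ) (hclosing : SatisfiesClosingLemma φ)
    (I : Finset {f : X → ℝ // BoundedLipschitz f}) :
    Convex ℝ (closure (periodicAverages φ I)) := by
  refine convex_iff_forall_pos.2 fun v hv w hw c d hc hd hcd => ?_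
  have hcont : Continuous fun z : (I → ℝ) × (I → ℝ) => c • z.1 + d • z.2 := by fun_prop
  rw [← closure_closure (s := periodicAverages φ I)]
  refine map_mem_closure₂ (f := fun v w : I → ℝ => c • v + d • w) hcont hv hw ?_
  rintro _ ⟨p, a, ha, hp, rfl⟩ _ ⟨q, b, hb, hq, rfl⟩
  refine Metric.mem_closure_iff.2 fun κ hκ => ?_
  obtain ⟨r, l, hl, hr, h⟩ := exists_periodic_average_near htrans hprod hclosing ha hb hp hq hc hd
    hcd I hκ
  refine ⟨_, ⟨r, l, hl, hr, rfl⟩, ?_⟩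
  rw [dist_comm]
  exact (dist_pi_lt_iff hκ).2 fun f => h f.1 f.2

/-- Periodic points are dense in a transitive flow that satisfies the closing lemma. -/
theorem exists_periodic_mem (htrans : IsTransitive φ) (hclosing : SatisfiesClosingLemma φ)
    {U : Set X} (hU : IsOpen U) (hne : U.Nonempty) : ∃ x ∈ U, ∃ l : ℝ, 0 < l ∧ φ l x = x := by
  obtain ⟨v, hv⟩ := hne
  obtain ⟨ε, hε, hεU⟩ := Metric.isOpen_iff.1 hU v hv
  obtain ⟨V, hV, hVε⟩ := hclosing v
  obtain ⟨δ, hδ, t₀, ht₀, hcl⟩ := hVε (ε / 2) (half_pos hε)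
  let W := interior V ∩ Metric.ball v (min (ε / 2) (δ / 2))
  have hW : IsOpen W := isOpen_interior.inter Metric.isOpen_ball
  have hvW : v ∈ W := ⟨mem_interior_iff_mem_nhds.2 hV,
    Metric.mem_ball_self (lt_min (half_pos hε) (half_pos hδ))⟩
  -- Starting from `φ (t₀ + 1) '' W` instead of `W` forces the return time beyond `t₀`.
  obtain ⟨t, ht, _, ⟨_, ⟨x, hx, rfl⟩, rfl⟩, hxt⟩ := htrans (φ (t₀ + 1) '' W) W
    ((φ.toHomeomorph (t₀ + 1)).isOpenMap W hW) (Set.Nonempty.image _ ⟨v, hvW⟩) hW ⟨v, hvW⟩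
  rw [← φ.map_add] at hxt
  have h1 := Metric.mem_ball.1 hx.2
  have h2 := Metric.mem_ball.1 hxt.2
  have h3 := min_le_left (ε / 2) (δ / 2)
  have h4 := min_le_right (ε / 2) (δ / 2)
  obtain ⟨x₀, l, hl, -, hx₀, hclose⟩ := hcl x (interior_subset hx.1) (t + (t₀ + 1)) (by linarith)
    (by linarith [dist_triangle_right x (φ (t + (t₀ + 1)) x) v]) (interior_subset hxt.1)
  have hm : 0 < min (t + (t₀ + 1)) l := lt_min (by linarith) hl
  have hO : ∀ᶠ s in 𝓝[>] (0 : ℝ), dist (φ s x) v < ε / 2 := by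
    refine nhdsWithin_le_nhds (((continuous_orbit φ x).dist continuous_const).continuousAt.eventually_lt
      continuousAt_const ?_)
    simp only [φ.map_zero_apply]
    linarith
  -- The closing lemma says nothing at `s = 0`, so the periodic point is taken at a small positive
  -- time.
  obtain ⟨s, hs, hs'⟩ := (hO.and (Ioo_mem_nhdsGT hm)).exists
  refine ⟨φ s x₀, hεU ?_, l, hl, ?_⟩
  · have := hclose s hs'.1 hs'.2
    exact Metric.mem_ball.2 (by linarith [dist_triangle (φ s x₀) (φ s x) v])
  · rw [← φ.map_add, add_comm, φ.map_add, hx₀]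

variable [MeasurableSpace X] [BorelSpace X]

/-- The measures on periodic orbits are dense in the invariant measures. -/
theorem invariantMeasures_subset_closure_periodicMeasures [SecondCountableTopology X]
    (htrans : IsTransitive φ) (hprod : HasLocalProductStructure φ)
    (hclosing : SatisfiesClosingLemma φ) :
    invariantMeasures φ ⊆ closure (periodicMeasures φ) := by
  classical
  intro μ hμ
  refine mem_closure_of_forall_boundedLipschitz fun I ε hε => ?_
  let w : I → ℝ := fun f => ∫ x, f.1.1 x ∂(μ : Measure X)
  have hw : w ∈ closure (periodicAverages φ I) := by
    by_contra hw
    obtain ⟨Λ, u, hΛw, hΛ⟩ := geometric_hahn_banach_point_closed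
      (convex_closure_periodicAverages htrans hprod hclosing I) isClosed_closure hw
    let e : I → ℝ := fun f => Λ fun j => if f = j then 1 else 0
    have hΛe : ∀ v : I → ℝ, Λ v = ∑ f, e f * v f := fun v => by
      have := LinearMap.pi_apply_eq_sum_univ (Λ : (I → ℝ) →ₗ[ℝ] ℝ) v
      simp only [smul_eq_mul, ContinuousLinearMap.coe_coe] at this
      rw [this]
      exact Finset.sum_congr rfl fun f _ => mul_comm _ _
    -- The separating functional as a function on `X`: its average is positive on every periodic
    -- orbit, while its `μ`-integral is negative.
    let F : X → ℝ := fun x => ∑ f : I, e f * f.1.1 x + -u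
    have hF : BoundedLipschitz F :=
      (BoundedLipschitz.sum _ fun f : I => f.1.2.const_mul (e f)).add (BoundedLipschitz.const _)
    have hFμ : ∫ x, F x ∂(μ : Measure X) = Λ w - u := by
      have hi : ∀ f ∈ (Finset.univ : Finset I),
          Integrable (fun x => e f * f.1.1 x) (μ : Measure X) := fun f _ =>
        (f.1.2.integrable _).const_mul _
      simp only [F]
      rw [integral_add (integrable_finsetSum _ hi) (integrable_const _),
        integral_finsetSum _ hi, hΛe]
      simp only [integral_const_mul, w]
      simp [sub_eq_add_neg]
    have hFper : ∀ (x : X) (l : ℝ), 0 < l → φ l x = x → 0 ≤ ∫ s in (0 : ℝ)..l, F (φ s x) := by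
      intro x l hl hx
      have h1 := hΛ _ (subset_closure (⟨x, l, hl, hx, rfl⟩ :
        (fun f : I => l⁻¹ * ∫ u in (0 : ℝ)..l, f.1.1 (φ u x)) ∈ periodicAverages φ I))
      rw [hΛe] at h1
      have hi : ∀ f ∈ (Finset.univ : Finset I),
          IntervalIntegrable (fun s => e f * f.1.1 (φ s x)) volume 0 l := fun f _ =>
        ((f.1.2.continuous.comp (continuous_orbit φ x)).intervalIntegrable _ _).const_mul _
      have h2 : ∫ s in (0 : ℝ)..l, F (φ s x) =
          l * (∑ f : I, e f * (l⁻¹ * ∫ u in (0 : ℝ)..l, f.1.1 (φ u x)) - u) := by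
        have hs : IntervalIntegrable (fun s => ∑ f : I, e f * f.1.1 (φ s x)) volume 0 l :=
          (continuous_finsetSum _ fun f _ => continuous_const.mul
            (f.1.2.continuous.comp (continuous_orbit φ x))).intervalIntegrable _ _
        simp only [F]
        rw [intervalIntegral.integral_add hs intervalIntegrable_const, intervalIntegral.integral_finsetSum hi]
        simp only [intervalIntegral.integral_const_mul, intervalIntegral.integral_const, sub_zero,
          smul_eq_mul, mul_sub, Finset.mul_sum]
        rw [mul_neg, ← sub_eq_add_neg]
        congr 1
        refine Finset.sum_congr rfl fun f _ => ?_
        field_simp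
      rw [h2]
      exact mul_nonneg hl.le (by linarith)
    have := integral_nonneg_of_periodic hclosing hF hFper hμ
    linarith
  obtain ⟨_, ⟨x, l, hl, hx, rfl⟩, hdist⟩ := Metric.mem_closure_iff.1 hw ε hε
  obtain ⟨ν, hν⟩ := exists_periodicMeasure φ x hl
  refine ⟨ν, ⟨x, l, hl, hx, hν⟩, fun f hf => ?_⟩
  rw [integral_periodicMeasure hl hν f.2.continuous.measurable.stronglyMeasurable, abs_sub_comm]
  exact (dist_pi_lt_iff hε).1 hdist ⟨f, hf⟩

/-- The measure carried by a periodic orbit charges the neighborhoods of the points of the orbit. -/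
theorem periodicMeasure_pos {x : X} {l : ℝ} (hl : 0 < l) {μ : Measure X}
    (hμ : μ = ENNReal.ofReal l⁻¹ • (volume.restrict (Ioc 0 l)).map fun s => φ s x)
    {U : Set X} (hU : IsOpen U) (hx : x ∈ U) : 0 < μ U := by
  have hcont := continuous_orbit φ x
  have hO : IsOpen ((fun s => φ s x) ⁻¹' U) := hU.preimage hcont
  have hmem : (fun s => φ s x) ⁻¹' U ∈ 𝓝[>] (0 : ℝ) :=
    nhdsWithin_le_nhds (hO.mem_nhds (by simpa using hx))
  have hne : (((fun s => φ s x) ⁻¹' U) ∩ Ioo 0 l).Nonempty :=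
    (Filter.inter_mem hmem (Ioo_mem_nhdsGT hl) |> nonempty_of_mem)
  have hpos := (hO.inter isOpen_Ioo).measure_pos volume hne
  rw [hμ, Measure.smul_apply, smul_eq_mul, Measure.map_apply hcont.measurable hU.measurableSet,
    Measure.restrict_apply (hU.measurableSet.preimage hcont.measurable)]
  refine ENNReal.mul_pos (by simpa using hl) (ne_of_gt (hpos.trans_le (measure_mono ?_)))
  exact inter_subset_inter_right _ Ioo_subset_Ioc_self

/-- If one invariant measure charges a set, then such measures are dense. -/
theorem invariantMeasures_subset_closure_pos {U : Set X} {ν : ProbabilityMeasure X}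
    (hν : ν ∈ invariantMeasures φ) (hνU : 0 < (ν : Measure X) U) :
    invariantMeasures φ ⊆ closure {μ | μ ∈ invariantMeasures φ ∧ 0 < (μ : Measure X) U} := by
  intro μ hμ
  refine mem_closure_of_forall_boundedLipschitz fun I ε hε => ?_
  obtain ⟨B, L, hB0, -, hBL⟩ := exists_common_bounds I
  -- `κ` is the weight given to `ν`; mixing changes each integral by at most `κ * (2 * B)`.
  obtain ⟨κ, hκ, hκ1, hκB⟩ : ∃ κ : ℝ, 0 < κ ∧ κ < 1 ∧ κ * (2 * B) < ε := by
    refine ⟨min (1 / 2) (ε / (2 * B + 1)), by positivity,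
      (min_le_left _ _).trans_lt (by norm_num), ?_⟩
    calc min (1 / 2) (ε / (2 * B + 1)) * (2 * B) ≤ ε / (2 * B + 1) * (2 * B) :=
          mul_le_mul_of_nonneg_right (min_le_right _ _) (by positivity)
      _ < ε := by
          rw [div_mul_eq_mul_div, div_lt_iff₀ (by positivity)]
          nlinarith
  let ρ : Measure X := ENNReal.ofReal (1 - κ) • (μ : Measure X) + ENNReal.ofReal κ • (ν : Measure X)
  have hρ : IsProbabilityMeasure ρ := by
    refine ⟨?_⟩
    simp only [ρ, Measure.add_apply, Measure.smul_apply, measure_univ, smul_eq_mul, mul_one]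
    rw [← ENNReal.ofReal_add (by linarith) hκ.le, sub_add_cancel, ENNReal.ofReal_one]
  refine ⟨⟨ρ, hρ⟩, ⟨fun t => ⟨(hμ t).measurable, ?_⟩, ?_⟩, fun f hf => ?_⟩
  · change ρ.map (φ t) = ρ
    simp only [ρ]
    rw [Measure.map_add _ _ (hμ t).measurable, Measure.map_smul, Measure.map_smul, (hμ t).map_eq,
      (hν t).map_eq]
  · change 0 < ρ U
    simp only [ρ, Measure.add_apply, Measure.smul_apply, smul_eq_mul]
    exact lt_of_lt_of_le (ENNReal.mul_pos (by simpa using hκ) hνU.ne') le_add_self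
  · change |∫ x, f.1 x ∂ρ - _| < ε
    have h1 : ∫ x, f.1 x ∂ρ = (1 - κ) * ∫ x, f.1 x ∂(μ : Measure X) +
        κ * ∫ x, f.1 x ∂(ν : Measure X) := by
      simp only [ρ]
      rw [integral_add_measure ((f.2.integrable _).smul_measure ENNReal.ofReal_ne_top)
        ((f.2.integrable _).smul_measure ENNReal.ofReal_ne_top), integral_smul_measure,
        integral_smul_measure, ENNReal.toReal_ofReal (by linarith), ENNReal.toReal_ofReal hκ.le]
      rfl
    have hb : ∀ m : ProbabilityMeasure X, |∫ x, f.1 x ∂(m : Measure X)| ≤ B := fun m => by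
      have := norm_integral_le_of_norm_le_const (μ := (m : Measure X)) (f := f.1) (C := B)
        (Eventually.of_forall (hBL f hf).1)
      simpa using this
    rw [h1, show (1 - κ) * ∫ x, f.1 x ∂(μ : Measure X) + κ * ∫ x, f.1 x ∂(ν : Measure X) -
      ∫ x, f.1 x ∂(μ : Measure X) =
      κ * (∫ x, f.1 x ∂(ν : Measure X) - ∫ x, f.1 x ∂(μ : Measure X)) by ring, abs_mul,
      abs_of_pos hκ]
    refine lt_of_le_of_lt (mul_le_mul_of_nonneg_left ?_ hκ.le) hκB
    refine (abs_sub _ _).trans ?_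
    linarith [hb μ, hb ν]

/-- Pushforward by a continuous map is weakly continuous, so each equation `μ.map (φ t) = μ` is
closed. -/
theorem isClosed_invariantMeasures (φ : Flow ℝ X) : IsClosed (invariantMeasures φ) := by
  have key : invariantMeasures φ = ⋂ t : ℝ, {μ : ProbabilityMeasure X |
      μ.map (continuous_flow φ t).measurable.aemeasurable = μ} := by
    ext μ
    simp only [mem_iInter, mem_ofPred_eq]
    refine forall_congr' fun t => ⟨fun h => ProbabilityMeasure.toMeasure_injective h.map_eq,
      fun h => ⟨(continuous_flow φ t).measurable, ?_⟩⟩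
    exact congrArg (fun ρ : ProbabilityMeasure X => (ρ : Measure X)) h
  rw [key]
  exact isClosed_iInter fun t =>
    isClosed_eq (ProbabilityMeasure.continuous_map (continuous_flow φ t)) continuous_id

theorem dense_setOf_of_subset_closure {M : Set (ProbabilityMeasure X)}
    {P : ProbabilityMeasure X → Prop} (h : M ⊆ closure {μ | μ ∈ M ∧ P μ}) :
    Dense {μ : M | P μ.1} := fun μ => by
  rw [closure_subtype]
  refine closure_mono ?_ (h μ.2)
  exact fun ν hν => ⟨⟨ν, hν.1⟩, hν.2, rfl⟩

end Density

end HyperbolicFlow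

theorem mainTheorem2 {X : Type*} [MetricSpace X] [PolishSpace X] [MeasurableSpace X]
    [BorelSpace X] (φ : Flow ℝ X)
    (htrans : HyperbolicFlow.IsTransitive φ)
    (hprod : HyperbolicFlow.HasLocalProductStructure φ)
    (hclosing : HyperbolicFlow.SatisfiesClosingLemma φ) :
    IsGδ {μ : HyperbolicFlow.invariantMeasures φ |
        HyperbolicFlow.IsErgodic φ μ.1 ∧ HyperbolicFlow.HasFullSupport μ.1} ∧
      Dense {μ : HyperbolicFlow.invariantMeasures φ |
        HyperbolicFlow.IsErgodic φ μ.1 ∧ HyperbolicFlow.HasFullSupport μ.1} := by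
  open HyperbolicFlow TopologicalSpace in
  have hbaire := baireSpace_of_isClosed_probabilityMeasure (isClosed_invariantMeasures φ)
  have hE : IsGδ {μ : invariantMeasures φ | IsErgodic φ μ.1} := isGδ_setOf_isErgodic φ
  have hEd : Dense {μ : invariantMeasures φ | IsErgodic φ μ.1} :=
    dense_setOf_of_subset_closure
      ((invariantMeasures_subset_closure_periodicMeasures htrans hprod hclosing).trans
        (closure_mono fun μ hμ => ⟨periodicMeasures_subset_invariantMeasures φ hμ,
          isErgodic_of_mem_periodicMeasures hμ⟩))
  have hFo : ∀ U ∈ countableBasis X, IsOpen {μ : invariantMeasures φ | 0 < (μ.1 : Measure X) U} :=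
    fun U hU => (isOpen_setOf_lt_measure (isOpen_of_mem_countableBasis hU) 0).preimage
      continuous_subtype_val
  have hFd : ∀ U ∈ countableBasis X, Dense {μ : invariantMeasures φ | 0 < (μ.1 : Measure X) U} := by
    intro U hU
    have hUo := isOpen_of_mem_countableBasis hU
    obtain ⟨x, hx, l, hl, hxl⟩ := exists_periodic_mem htrans hclosing hUo
      (nonempty_of_mem_countableBasis hU)
    obtain ⟨ν, hν⟩ := exists_periodicMeasure φ x hl
    exact dense_setOf_of_subset_closure (M := invariantMeasures φ)
      (P := fun μ : ProbabilityMeasure X => 0 < (μ : Measure X) U)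
      (invariantMeasures_subset_closure_pos
        (periodicMeasures_subset_invariantMeasures φ ⟨x, l, hl, hxl, hν⟩)
        (periodicMeasure_pos hl hν hUo hx))
  have hF : IsGδ {μ : invariantMeasures φ | HasFullSupport μ.1} := by
    rw [setOf_hasFullSupport_eq]
    exact .biInter_of_isOpen (countable_countableBasis X) hFo
  have hFd' : Dense {μ : invariantMeasures φ | HasFullSupport μ.1} := by
    rw [setOf_hasFullSupport_eq]
    exact dense_biInter_of_isOpen hFo (countable_countableBasis X) hFd
  -- In the Baire space of invariant measures, two dense Gδ sets have dense intersection.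
  exact ⟨hE.inter hF, hEd.inter_of_Gδ hE hF hFd'⟩
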